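/- Let $\mathbb{R}_+^n$ be the set of all $x\in\mathbb{R}^n$ with strictly positive coordinates. For $0<p\le 1$, a set $K\subset\mathbb{R}_+^n$ is called $p$-convex if $\{(x_1^p,\dots,x_n^p) : (x_1,\dots,x_n)\in K\}$ is a convex set. **Corollary 1.2.** Let $n\ge 1$ and $\ell>1$ be integers, and let $K\subset\mathbb{R}_+^n$ be a $(1/\ell)$-convex set with non-empty interior. Then for every locally Lipschitz, integrable function $f:K\to\mathbb{R}$ with $\int_K f\,dx=0$, $$\int_K f^2\,dx\;\le\;\frac{\ell^2}{\ell-1}\,\sum_{i=1}^n\int_K x_i^2\,\bigl|\partial_i f(x)\bigr|^2\,dx .$$ Here the integrals are with respect to Lebesgue measure, $\partial_i f=\partial f/\partial x_i$ is the partial derivative with respect to the $i$-th variable (it exists at almost every point of $K$), and both sides are understood in $[0,\infty]$; in particular, if the right-hand side is finite, then $f\in L^2(K)$. -/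

import Mathlib

open MeasureTheory

/-- The orthant of all points of `ℝⁿ` whose coordinates are (strictly) positive. -/
def posOrthant (n : ℕ) : Set (Fin n → ℝ) := {x | ∀ i, 0 < x i}

/-- A set `K` of points with positive coordinates is `p`-convex when
`{(x₁ ^ p, …, xₙ ^ p) ; x ∈ K}` is a convex set. -/
def IsPConvex {n : ℕ} (p : ℝ) (K : Set (Fin n → ℝ)) : Prop :=
  K ⊆ posOrthant n ∧ Convex ℝ ((fun (x : Fin n → ℝ) (i : Fin n) => x i ^ p) '' K)

/-- The partial derivative of `f` at `x` with respect to the `i`-th variable. -/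
noncomputable def partialDeriv {n : ℕ} (i : Fin n) (f : (Fin n → ℝ) → ℝ) (x : Fin n → ℝ) : ℝ :=
  lineDeriv ℝ f x (Pi.single i 1)

/-! The substitution `x i = y i ^ ℓ` turns `K`, up to a null set, into an open convex set `V`, and
Lebesgue measure into the density `ρ = ∏ ℓ * y i ^ (ℓ - 1)`
(`IsPConvex.exists_isOpen_convex_image_ae_eq`, `abs_det_coordPowDeriv`). The Hessian of `-log ρ` is
diagonal with entries `(ℓ - 1) / y i ^ 2`, so the Brascamp–Lieb inequality bounds the variance of
`g` by `1 / (ℓ - 1)` times the sum of the integrals of `(y i * ∂ᵢ g) ^ 2`. For `g y = f (coordPow ℓ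
y)` the chain rule gives `y i * ∂ᵢ g = ℓ * x i * ∂ᵢ f`, whence the constant `ℓ ^ 2 / (ℓ - 1)`.

Brascamp–Lieb itself comes from the midpoint inequality `prekopaLeindler`, applied in
`exp_moments_le` to `ρ * exp (ε g)` and `ρ * exp (-ε g)`. The third function involves the supremum,
over all directions, of a difference quotient of `g` minus half the Hessian form of `-log ρ`. As `ε
→ 0` the limsup of this supremum is at most the Legendre transform of the quadratic form at the
gradient, and comparing the coefficients of `ε ^ 2` (`lintegral_sq_le_of_exp_moments`) gives the
variance bound for Lipschitz `g` on bounded sets. Exhaustion from inside extends it to locally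
Lipschitz `g` on any open convex `V`. -/

/-! ### Midpoint Brunn–Minkowski and Prékopa–Leindler inequalities -/

/-- One-dimensional Brunn–Minkowski inequality for midpoints. -/
theorem volume_add_volume_le_of_midpoint_mem {A B C : Set ℝ} (hA : MeasurableSet A)
    (hB : MeasurableSet B) (hA0 : A.Nonempty) (hB0 : B.Nonempty)
    (h : ∀ x ∈ A, ∀ y ∈ B, (x + y) / 2 ∈ C) :
    volume A + volume B ≤ 2 * volume C := by
  have key : ∀ K ⊆ A, IsCompact K → ∀ L ⊆ B, IsCompact L → K.Nonempty → L.Nonempty →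
      volume K + volume L ≤ 2 * volume C := by
    intro K hKA hK L hLB hL hK0 hL0
    obtain ⟨a, haK, ha⟩ := hK.exists_isGreatest hK0
    obtain ⟨b, hbL, hb⟩ := hL.exists_isLeast hL0
    have h2 : volume ((fun x : ℝ => (1 / 2 : ℝ) * x) ⁻¹' C) = 2 * volume C := by
      rw [Real.volume_preimage_mul_left (by norm_num)]
      norm_num
    rw [← h2]
    -- With `a = max K` and `b = min L`, the translates `K + b` and `L + a` both lie in `2 C` and
    -- meet at most in `a + b`.
    have e1 : volume ((fun x => x + (-b)) ⁻¹' K) = volume K := measure_preimage_add_right _ _ _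
    have e2 : volume ((fun x => (-a) + x) ⁻¹' L) = volume L := measure_preimage_add _ _ _
    rw [← e1, ← e2, ← measure_union₀]
    · apply measure_mono
      rintro x (hx | hx)
      · have := h _ (hKA hx) b (hLB hbL)
        simp only [Set.mem_preimage]
        convert this using 1
        ring
      · have := h a (hKA haK) _ (hLB hx)
        simp only [Set.mem_preimage]
        convert this using 1
        ring
    · exact (hL.measurableSet.preimage (by fun_prop)).nullMeasurableSet
    · apply measure_mono_null (t := {a + b})
      · rintro x ⟨hx1, hx2⟩
        have h1 := ha hx1
        have h2 := hb hx2
        simp only [Set.mem_singleton_iff]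
        linarith
      · simp
  obtain ⟨a0, ha0⟩ := hA0
  obtain ⟨b0, hb0⟩ := hB0
  -- Inserting a point of `A` and a point of `B` disposes of empty compact sets before inner
  -- regularity is applied.
  have key2 : ∀ K ⊆ A, IsCompact K → ∀ L ⊆ B, IsCompact L →
      volume K + volume L ≤ 2 * volume C := by
    intro K hKA hK L hLB hL
    refine le_trans (add_le_add (measure_mono (Set.subset_insert a0 K))
      (measure_mono (Set.subset_insert b0 L))) ?_
    exact key _ (Set.insert_subset ha0 hKA) (hK.insert a0) _ (Set.insert_subset hb0 hLB)
      (hL.insert b0) (Set.insert_nonempty _ _) (Set.insert_nonempty _ _)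
  rw [hA.measure_eq_iSup_isCompact, hB.measure_eq_iSup_isCompact]
  simp only [iSup_and']
  rw [ENNReal.biSup_add' ⟨∅, by simp⟩]
  refine iSup₂_le fun K hK => ?_
  rw [ENNReal.add_biSup' ⟨∅, by simp⟩]
  exact iSup₂_le fun L hL => key2 K hK.1 hK.2 L hL.1 hL.2

theorem lintegral_eq_lintegral_Ioo_meas_lt {u : ℝ → ENNReal} (hu : Measurable u)
    (h1 : ∀ x, u x ≤ 1) :
    ∫⁻ x, u x = ∫⁻ t in Set.Ioo (0 : ℝ) 1, volume {x | ENNReal.ofReal t < u x} := by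
  have hfin : ∀ x, u x ≠ ⊤ := fun x => ne_top_of_le_ne_top ENNReal.one_ne_top (h1 x)
  have e : ∀ x, u x = ENNReal.ofReal (u x).toReal := fun x => (ENNReal.ofReal_toReal (hfin x)).symm
  have e' : ∫⁻ x, u x = ∫⁻ x, ENNReal.ofReal (u x).toReal := lintegral_congr e
  rw [e', lintegral_eq_lintegral_meas_lt _ (.of_forall fun x => ENNReal.toReal_nonneg)
    hu.ennreal_toReal.aemeasurable]
  have hs : Set.Ioi (0 : ℝ) = Set.Ioo 0 1 ∪ Set.Ici 1 := by
    ext x; simp only [Set.mem_Ioi, Set.mem_union, Set.mem_Ioo, Set.mem_Ici]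
    constructor
    · intro h; rcases lt_or_ge x 1 with h' | h' <;> simp [h, h']
    · rintro (h | h) <;> linarith
  have hz : ∫⁻ t in Set.Ici (1 : ℝ), volume {x | t < (u x).toReal} = 0 := by
    rw [setLIntegral_congr_fun (g := fun _ => 0) measurableSet_Ici]
    · simp
    · intro t ht
      have : {x | t < (u x).toReal} = ∅ := by
        ext x
        simp only [Set.mem_ofPred_eq, Set.mem_empty_iff_false, iff_false, not_lt]
        refine le_trans ?_ ht
        exact ENNReal.toReal_le_of_le_ofReal zero_le_one (by simpa using h1 x)
      simp [this]
  rw [hs, lintegral_union measurableSet_Ici, hz, add_zero]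
  · refine setLIntegral_congr_fun measurableSet_Ioo fun t ht => ?_
    congr 1
    ext x
    simp only [Set.mem_ofPred_eq]
    rw [ENNReal.ofReal_lt_iff_lt_toReal ht.1.le (hfin x)]
  · rw [Set.disjoint_left]; intro x hx hx'; exact absurd hx.2 (not_lt.mpr hx')

/-- Because both suprema equal 1, the superlevel sets of `u` and `v` are nonempty at every level `t
< 1`; Brunn–Minkowski applies at each level and the layer-cake formula integrates it. The
normalisation is what makes this additive form available. -/
theorem prekopaLeindler_real_normalized {u v w : ℝ → ENNReal} (hu : Measurable u)
    (hv : Measurable v) (hw : Measurable w) (hu1 : ⨆ x, u x = 1) (hv1 : ⨆ x, v x = 1)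
    (h : ∀ x y, u x * v y ≤ w ((x + y) / 2) ^ 2) :
    (∫⁻ x, u x) + ∫⁻ x, v x ≤ 2 * ∫⁻ x, w x := by
  have hu' : ∀ x, u x ≤ 1 := fun x => hu1 ▸ le_iSup u x
  have hv' : ∀ x, v x ≤ 1 := fun x => hv1 ▸ le_iSup v x
  have hw' : ∫⁻ x, min (w x) 1 ≤ ∫⁻ x, w x := lintegral_mono fun x => min_le_left _ _
  refine le_trans ?_ (mul_le_mul_right hw' 2)
  rw [lintegral_eq_lintegral_Ioo_meas_lt hu hu', lintegral_eq_lintegral_Ioo_meas_lt hv hv',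
    lintegral_eq_lintegral_Ioo_meas_lt (hw.min measurable_const) (fun x => min_le_right _ _),
    ← lintegral_const_mul' _ _ (by simp), ← lintegral_add_left']
  · refine setLIntegral_mono' measurableSet_Ioo fun t ht => ?_
    have ht1 : ENNReal.ofReal t < 1 := by
      rw [← ENNReal.ofReal_one]; exact (ENNReal.ofReal_lt_ofReal_iff one_pos).2 ht.2
    apply volume_add_volume_le_of_midpoint_mem
    · exact measurableSet_lt measurable_const hu
    · exact measurableSet_lt measurable_const hv
    · exact lt_iSup_iff.1 (hu1 ▸ ht1)
    · exact lt_iSup_iff.1 (hv1 ▸ ht1)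
    · intro x hx y hy
      simp only [Set.mem_ofPred_eq, lt_min_iff] at *
      refine ⟨?_, ht1⟩
      by_contra hc
      have h1 := (h x y).trans (pow_le_pow_left' (not_lt.1 hc) 2)
      have h2 : ENNReal.ofReal t * ENNReal.ofReal t < u x * v y := ENNReal.mul_lt_mul hx hy
      rw [← pow_two] at h2
      exact absurd h1 (not_le.2 h2)
  · refine Measurable.aemeasurable ?_
    exact (Antitone.measurable fun s t hst => measure_mono fun x hx =>
      lt_of_le_of_lt (ENNReal.ofReal_le_ofReal hst) hx)

theorem ENNReal.mul_le_sq_of_add_le {a b c : ENNReal} (h : a + b ≤ 2 * c) : a * b ≤ c ^ 2 := by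
  rcases eq_or_ne c ⊤ with rfl | hc
  · simp
  have hab : a + b ≠ ⊤ := ne_top_of_le_ne_top (ENNReal.mul_ne_top (by simp) hc) h
  obtain ⟨ha, hb⟩ := ENNReal.add_ne_top.1 hab
  lift a to NNReal using ha
  lift b to NNReal using hb
  lift c to NNReal using hc
  norm_cast at *
  rw [← NNReal.coe_le_coe] at *
  push_cast at *
  have := a.coe_nonneg
  have := b.coe_nonneg
  nlinarith [sq_nonneg ((a : ℝ) - b), sq_nonneg ((a : ℝ) + b)]

/-- Divide `u` and `v` by their suprema and `w` by the geometric mean of these; AM–GM then turns the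
normalised additive bound into the product form. -/
theorem prekopaLeindler_real_of_bounded {u v w : ℝ → ENNReal} (hu : Measurable u)
    (hv : Measurable v) (hw : Measurable w) (hu1 : ⨆ x, u x ≠ ⊤) (hv1 : ⨆ x, v x ≠ ⊤)
    (h : ∀ x y, u x * v y ≤ w ((x + y) / 2) ^ 2) :
    (∫⁻ x, u x) * ∫⁻ x, v x ≤ (∫⁻ x, w x) ^ 2 := by
  set a := ⨆ x, u x with ha
  set b := ⨆ x, v x with hb
  rcases eq_or_ne a 0 with ha0 | ha0
  · have : ∀ x, u x = 0 := fun x => le_antisymm (ha0 ▸ le_iSup u x) bot_le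
    simp [this]
  rcases eq_or_ne b 0 with hb0 | hb0
  · have : ∀ x, v x = 0 := fun x => le_antisymm (hb0 ▸ le_iSup v x) bot_le
    simp [this]
  obtain ⟨c, hc⟩ : ∃ c : ENNReal, c ^ 2 = a * b := by
    refine ⟨(a * b) ^ (1 / 2 : ℝ), ?_⟩
    rw [← ENNReal.rpow_natCast, ← ENNReal.rpow_mul]; norm_num
  have hab0 : a * b ≠ 0 := mul_ne_zero ha0 hb0
  have habt : a * b ≠ ⊤ := ENNReal.mul_ne_top hu1 hv1
  have key := prekopaLeindler_real_normalized (u := fun x => a⁻¹ * u x) (v := fun x => b⁻¹ * v x)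
    (w := fun x => c⁻¹ * w x) (hu.const_mul _) (hv.const_mul _) (hw.const_mul _)
    (by rw [← ENNReal.mul_iSup, ← ha, ENNReal.inv_mul_cancel ha0 hu1])
    (by rw [← ENNReal.mul_iSup, ← hb, ENNReal.inv_mul_cancel hb0 hv1])
    (fun x y => by
      rw [mul_pow, ← ENNReal.inv_pow, hc, ENNReal.mul_inv (.inl ha0) (.inl hu1),
        mul_mul_mul_comm]
      exact mul_le_mul_right (h x y) _)
  have key2 := ENNReal.mul_le_sq_of_add_le key
  rw [lintegral_const_mul _ hu, lintegral_const_mul _ hv, lintegral_const_mul _ hw,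
    mul_mul_mul_comm, mul_pow, ← ENNReal.inv_pow, hc,
    ← ENNReal.mul_inv (.inl ha0) (.inl hu1)] at key2
  have := mul_le_mul_right key2 (a * b)
  rwa [← mul_assoc, ENNReal.mul_inv_cancel hab0 habt, one_mul, ← mul_assoc (a * b),
    ENNReal.mul_inv_cancel hab0 habt, one_mul] at this

/-- The Prékopa–Leindler inequality on the line, for midpoints. -/
theorem prekopaLeindler_real {u v w : ℝ → ENNReal} (hu : Measurable u)
    (hv : Measurable v) (hw : Measurable w) (h : ∀ x y, u x * v y ≤ w ((x + y) / 2) ^ 2) :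
    (∫⁻ x, u x) * ∫⁻ x, v x ≤ (∫⁻ x, w x) ^ 2 := by
  rcases eq_or_ne (∫⁻ x, u x) 0 with hu0 | hu0
  · simp [hu0]
  rcases eq_or_ne (∫⁻ x, v x) 0 with hv0 | hv0
  · simp [hv0]
  have lim : ∀ f : ℝ → ENNReal, Measurable f → Filter.Tendsto
      (fun N : ℕ => ∫⁻ x, min (f x) N) Filter.atTop (nhds (∫⁻ x, f x)) := by
    intro f hf
    refine lintegral_tendsto_of_tendsto_of_monotone
      (fun N => (hf.min measurable_const).aemeasurable) (.of_forall fun x => ?_)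
      (.of_forall fun x => ?_)
    · intro N M hNM
      exact min_le_min_left _ (by exact_mod_cast hNM)
    · have := (tendsto_const_nhds (x := f x)).min ENNReal.tendsto_nat_nhds_top
      simpa using this
  refine le_of_tendsto (ENNReal.Tendsto.mul (lim u hu) (.inl hu0) (lim v hv) (.inl hv0))
    (.of_forall fun N => ?_)
  refine prekopaLeindler_real_of_bounded (hu.min measurable_const) (hv.min measurable_const) hw
    ?_ ?_ fun x y => (mul_le_mul' (min_le_left _ _) (min_le_left _ _)).trans (h x y)
  · exact ne_top_of_le_ne_top (ENNReal.natCast_ne_top N) (iSup_le fun x => min_le_right _ _)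
  · exact ne_top_of_le_ne_top (ENNReal.natCast_ne_top N) (iSup_le fun x => min_le_right _ _)

theorem lintegral_finCons {n : ℕ} {u : (Fin (n + 1) → ℝ) → ENNReal} (hu : Measurable u) :
    ∫⁻ x, u x = ∫⁻ s : ℝ, ∫⁻ y : Fin n → ℝ, u (Fin.cons s y) := by
  have e := (volume_preserving_piFinSuccAbove (fun _ : Fin (n + 1) => ℝ) 0).symm
  rw [← e.lintegral_comp hu, Measure.volume_eq_prod, lintegral_prod]
  · simp [MeasurableEquiv.piFinSuccAbove, Fin.insertNthEquiv]
  · exact (hu.comp e.measurable).aemeasurable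

/-- The Prékopa–Leindler inequality, for midpoints. -/
theorem prekopaLeindler {n : ℕ} {u v w : (Fin n → ℝ) → ENNReal} (hu : Measurable u)
    (hv : Measurable v) (hw : Measurable w)
    (h : ∀ x y, u x * v y ≤ w ((1 / 2 : ℝ) • (x + y)) ^ 2) :
    (∫⁻ x, u x) * ∫⁻ x, v x ≤ (∫⁻ x, w x) ^ 2 := by
  induction n with
  | zero =>
    have : ∀ f : (Fin 0 → ℝ) → ENNReal, ∫⁻ x, f x = f 0 := fun f => by
      rw [lintegral_unique, volume_pi, Measure.pi_univ, Finset.univ_eq_empty,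
        Finset.prod_empty, mul_one]
      exact congrArg f (Subsingleton.elim _ _)
    simpa [this] using h 0 0
  | succ n ih =>
    have hc : Measurable fun p : ℝ × (Fin n → ℝ) => (Fin.cons p.1 p.2 : Fin (n + 1) → ℝ) := by
      rw [measurable_pi_iff]
      intro i
      refine Fin.cases ?_ (fun j => ?_) i
      · simpa using measurable_fst
      · simp only [Fin.cons_succ]
        fun_prop
    rw [lintegral_finCons hu, lintegral_finCons hv, lintegral_finCons hw]
    refine prekopaLeindler_real (hu.comp hc).lintegral_prod_right'
      (hv.comp hc).lintegral_prod_right' (hw.comp hc).lintegral_prod_right' fun s t => ?_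
    refine ih ((hu.comp hc).comp measurable_prodMk_left) ((hv.comp hc).comp measurable_prodMk_left)
      ((hw.comp hc).comp measurable_prodMk_left) fun x y => ?_
    convert h (Fin.cons s x) (Fin.cons t y) using 3
    ext i
    refine Fin.cases ?_ (fun j => ?_) i
    · simp; ring
    · simp; ring

/-! ### Variance bounds from exponential moments -/

/-- The derivative of the cubic remainder is the quadratic remainder, which is increasing and
vanishes at 0; so the cubic remainder has its minimum at 0. -/
theorem Real.cubic_le_exp (t : ℝ) : 1 + t + t ^ 2 / 2 + t ^ 3 / 6 ≤ Real.exp t := by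
  have dF : ∀ x, HasDerivAt (fun x : ℝ => Real.exp x - (1 + x + x ^ 2 / 2))
      (Real.exp x - (1 + x)) x := fun x => by
    refine ((Real.hasDerivAt_exp x).sub (((hasDerivAt_id' x).const_add 1).add
      (((hasDerivAt_id' x).pow 2).div_const 2))).congr_deriv ?_
    norm_num
  have dG : ∀ x, HasDerivAt (fun x : ℝ => Real.exp x - (1 + x + x ^ 2 / 2 + x ^ 3 / 6))
      (Real.exp x - (1 + x + x ^ 2 / 2)) x := fun x => by
    refine ((Real.hasDerivAt_exp x).sub ((((hasDerivAt_id' x).const_add 1).add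
      (((hasDerivAt_id' x).pow 2).div_const 2)).add
      (((hasDerivAt_id' x).pow 3).div_const 6))).congr_deriv ?_
    norm_num
    ring
  have mF : Monotone fun x : ℝ => Real.exp x - (1 + x + x ^ 2 / 2) :=
    monotone_of_deriv_nonneg (fun x => (dF x).differentiableAt) fun x => by
      rw [(dF x).deriv]; linarith [Real.add_one_le_exp x]
  rcases le_total 0 t with ht | ht
  · have := monotoneOn_of_deriv_nonneg (convex_Ici (0 : ℝ))
      (fun x _ => (dG x).continuousAt.continuousWithinAt)
      (fun x _ => (dG x).differentiableAt.differentiableWithinAt)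
      (fun x hx => by
        rw [(dG x).deriv]
        have := mF (Set.mem_Ici.1 (interior_subset hx))
        simpa using this) (Set.mem_Ici.2 le_rfl) (Set.mem_Ici.2 ht) ht
    simp at this
    linarith
  · have := antitoneOn_of_deriv_nonpos (convex_Iic (0 : ℝ))
      (fun x _ => (dG x).continuousAt.continuousWithinAt)
      (fun x _ => (dG x).differentiableAt.differentiableWithinAt)
      (fun x hx => by
        rw [(dG x).deriv]
        have := mF (Set.mem_Iic.1 (interior_subset hx))
        simpa using this) (Set.mem_Iic.2 ht) (Set.mem_Iic.2 le_rfl) ht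
    simp at this
    linarith

open Filter Topology in
/-- A second order expansion of exponential moments gives a variance bound. -/
theorem lintegral_sq_le_of_exp_moments {α : Type*} [MeasurableSpace α] {μ : Measure α}
    [IsFiniteMeasure μ] {g : α → ℝ} (hg : AEStronglyMeasurable g μ) {C : ℝ}
    (hgC : ∀ᵐ x ∂μ, |g x| ≤ C) (h0 : ∫ x, g x ∂μ = 0) {Q : ℕ → α → ENNReal} {q : α → ENNReal}
    {B : ℝ} {ε : ℕ → ℝ} (hε0 : ∀ k, 0 < ε k) (hε : Tendsto ε atTop (𝓝 0))
    (hQm : ∀ k, Measurable (Q k)) (hQB : ∀ k, ∀ᵐ x ∂μ, Q k x ≤ ENNReal.ofReal B)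
    (hlim : ∀ᵐ x ∂μ, limsup (fun k => Q k x) atTop ≤ q x)
    (h : ∀ k, (∫⁻ x, ENNReal.ofReal (Real.exp (ε k * g x)) ∂μ) *
        (∫⁻ x, ENNReal.ofReal (Real.exp (-(ε k * g x))) ∂μ) ≤
      (μ Set.univ + ENNReal.ofReal (ε k ^ 2 * Real.exp (ε k ^ 2 * B)) * ∫⁻ x, Q k x ∂μ) ^ 2) :
    ∫⁻ x, ENNReal.ofReal (g x ^ 2) ∂μ ≤ 2 * ∫⁻ x, q x ∂μ := by
  rcases eq_or_ne μ 0 with rfl | hμ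
  · simp
  have hM : 0 < μ.real Set.univ := by
    rw [measureReal_def]
    exact ENNReal.toReal_pos (by simpa using hμ) (measure_ne_top _ _)
  set M := μ.real Set.univ with hMdef
  have hpow : ∀ j : ℕ, Integrable (fun x => g x ^ j) μ := fun j => by
    refine Integrable.of_bound (hg.pow j) (C ^ j) ?_
    filter_upwards [hgC] with x hx
    rw [Real.norm_eq_abs, abs_pow]
    gcongr
  have hexp : ∀ s : ℝ, Integrable (fun x => Real.exp (s * g x)) μ := fun s => by
    refine Integrable.of_bound
      (Real.continuous_exp.comp_aestronglyMeasurable (hg.const_mul s)) (Real.exp (|s| * C)) ?_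
    filter_upwards [hgC] with x hx
    rw [Real.norm_eq_abs, Real.abs_exp]
    refine Real.exp_le_exp.2 ?_
    calc s * g x ≤ |s * g x| := le_abs_self _
      _ = |s| * |g x| := abs_mul _ _
      _ ≤ |s| * C := by gcongr
  set S := ∫ x, g x ^ 2 ∂μ with hS
  set T := ∫ x, g x ^ 3 ∂μ with hT
  have hlow : ∀ s : ℝ, M + s ^ 2 * S / 2 + s ^ 3 * T / 6 ≤ ∫ x, Real.exp (s * g x) ∂μ := by
    intro s
    have e : M + s ^ 2 * S / 2 + s ^ 3 * T / 6 =
        ∫ x, (1 + s * g x + s ^ 2 / 2 * g x ^ 2 + s ^ 3 / 6 * g x ^ 3) ∂μ := by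
      have i1 : Integrable (fun x => s * g x) μ := by simpa using (hpow 1).const_mul s
      rw [integral_add, integral_add, integral_add, integral_const_mul, integral_const_mul,
        integral_const_mul, h0, ← hS, ← hT]
      · simp [hMdef]; ring
      · exact integrable_const _
      · exact i1
      · exact (integrable_const _).add i1
      · exact (hpow 2).const_mul _
      · exact ((integrable_const _).add i1).add ((hpow 2).const_mul _)
      · exact (hpow 3).const_mul _
    rw [e]
    have i1 : Integrable (fun x => s * g x) μ := by simpa using (hpow 1).const_mul s
    refine integral_mono ((((integrable_const _).add i1).add ((hpow 2).const_mul _)).add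
      ((hpow 3).const_mul _)) (hexp s) fun x => ?_
    have := Real.cubic_le_exp (s * g x)
    simp only
    nlinarith [this]
  have hlS : ∫⁻ x, ENNReal.ofReal (g x ^ 2) ∂μ = ENNReal.ofReal S :=
    (ofReal_integral_eq_lintegral_ofReal (hpow 2) (.of_forall fun x => sq_nonneg _)).symm
  have hle : ∀ s : ℝ, ∫⁻ x, ENNReal.ofReal (Real.exp (s * g x)) ∂μ =
      ENNReal.ofReal (∫ x, Real.exp (s * g x) ∂μ) := fun s =>
    (ofReal_integral_eq_lintegral_ofReal (hexp s) (.of_forall fun x => (Real.exp_pos _).le)).symm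
  -- Reverse Fatou; the constant `B` is an integrable majorant since `μ` is finite.
  have hlimsup : limsup (fun k => ∫⁻ x, Q k x ∂μ) atTop ≤ ∫⁻ x, q x ∂μ :=
    (limsup_lintegral_le (fun _ => ENNReal.ofReal B) hQm hQB
      (by simpa using ENNReal.mul_ne_top ENNReal.ofReal_ne_top (measure_ne_top _ _))).trans
      (lintegral_mono_ae hlim)
  suffices H : ∀ r : ℝ, 0 ≤ r → ∫⁻ x, q x ∂μ < ENNReal.ofReal r → S ≤ 2 * r by
    rw [hlS]
    refine ENNReal.le_of_forall_pos_le_add fun η hη hfin => ?_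
    have hqf : ∫⁻ x, q x ∂μ ≠ ⊤ := fun hq => by simp [hq] at hfin
    have := H ((∫⁻ x, q x ∂μ).toReal + η / 2) (by positivity) (by
      rw [ENNReal.lt_ofReal_iff_toReal_lt hqf]
      have : (0 : ℝ) < η := hη
      linarith)
    calc ENNReal.ofReal S ≤ ENNReal.ofReal (2 * (∫⁻ x, q x ∂μ).toReal + η) :=
          ENNReal.ofReal_le_ofReal (by linarith)
      _ = 2 * (∫⁻ x, q x ∂μ) + η := by
          rw [ENNReal.ofReal_add (by positivity) η.coe_nonneg, ENNReal.ofReal_mul (by norm_num),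
            ENNReal.ofReal_toReal hqf]
          simp
  intro r hr hqr
  have hev := eventually_lt_of_limsup_lt (hlimsup.trans_lt hqr)
  have hkey : ∀ᶠ k in atTop, M * S + ε k ^ 2 * S ^ 2 / 4 - ε k ^ 4 * T ^ 2 / 36 ≤
      2 * M * Real.exp (ε k ^ 2 * B) * r + ε k ^ 2 * (Real.exp (ε k ^ 2 * B) * r) ^ 2 := by
    -- Positivity of the lower bound at `-ε k` is needed to multiply the two lower bounds.
    have hpos : ∀ᶠ k in atTop, 0 < M + (-ε k) ^ 2 * S / 2 + (-ε k) ^ 3 * T / 6 := by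
      have : Tendsto (fun k => M + (-ε k) ^ 2 * S / 2 + (-ε k) ^ 3 * T / 6) atTop
          (𝓝 (M + (-0) ^ 2 * S / 2 + (-0) ^ 3 * T / 6)) :=
        ((((hε.neg.pow 2).mul_const S).div_const 2).const_add M).add
          (((hε.neg.pow 3).mul_const T).div_const 6)
      exact this.eventually (lt_mem_nhds (by simpa using hM))
    filter_upwards [hev, hpos] with k hk hp
    have hk2 := h k
    simp only [← neg_mul] at hk2
    rw [hle, hle] at hk2
    have hbd : μ Set.univ + ENNReal.ofReal (ε k ^ 2 * Real.exp (ε k ^ 2 * B)) * ∫⁻ x, Q k x ∂μ ≤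
        ENNReal.ofReal (M + ε k ^ 2 * Real.exp (ε k ^ 2 * B) * r) := by
      rw [ENNReal.ofReal_add hM.le (by positivity), ENNReal.ofReal_mul (q := r) (by positivity)]
      gcongr
      rw [hMdef, ofReal_measureReal]
    have h3 := hk2.trans (pow_le_pow_left' hbd 2)
    have hA := integral_nonneg (μ := μ) (f := fun x => Real.exp (ε k * g x))
      (fun x => (Real.exp_pos _).le)
    rw [← ENNReal.ofReal_mul hA, ← ENNReal.ofReal_pow (by positivity),
      ENNReal.ofReal_le_ofReal_iff (by positivity)] at h3
    have l1 := hlow (ε k)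
    have l2 := hlow (-ε k)
    -- The cubic terms at `ε k` and `-ε k` have opposite signs, so the product is a difference of
    -- squares and `T` enters only at order `ε ^ 6`. After cancelling `M ^ 2`, division by `ε ^ 2`
    -- leaves the wanted inequality in the limit.
    have h4 : (M + ε k ^ 2 * S / 2) ^ 2 - (ε k ^ 3 * T / 6) ^ 2 ≤
        (M + ε k ^ 2 * Real.exp (ε k ^ 2 * B) * r) ^ 2 := by
      refine le_trans ?_ h3
      refine le_trans ?_ (mul_le_mul_of_nonneg_left l2 hA)
      refine le_trans (le_of_eq ?_) (mul_le_mul_of_nonneg_right l1 hp.le)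
      ring
    have h5 : ε k ^ 2 * (M * S + ε k ^ 2 * S ^ 2 / 4 - ε k ^ 4 * T ^ 2 / 36) ≤ ε k ^ 2 *
      (2 * M * Real.exp (ε k ^ 2 * B) * r + ε k ^ 2 * (Real.exp (ε k ^ 2 * B) * r) ^ 2) := by
      nlinarith [h4]
    exact le_of_mul_le_mul_left h5 (pow_pos (hε0 k) 2)
  have hexpl : Tendsto (fun k => Real.exp (ε k ^ 2 * B)) atTop (𝓝 1) := by
    have := (Real.continuous_exp.tendsto _).comp ((hε.pow 2).mul_const B)
    simpa [Function.comp_def] using this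
  have hL : Tendsto (fun k => M * S + ε k ^ 2 * S ^ 2 / 4 - ε k ^ 4 * T ^ 2 / 36) atTop
      (𝓝 (M * S + 0 ^ 2 * S ^ 2 / 4 - 0 ^ 4 * T ^ 2 / 36)) :=
    ((((hε.pow 2).mul_const _).div_const _).const_add _).sub
      (((hε.pow 4).mul_const _).div_const _)
  have hR : Tendsto (fun k => 2 * M * Real.exp (ε k ^ 2 * B) * r +
      ε k ^ 2 * (Real.exp (ε k ^ 2 * B) * r) ^ 2) atTop
      (𝓝 (2 * M * 1 * r + 0 ^ 2 * (1 * r) ^ 2)) :=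
    ((hexpl.const_mul _).mul_const _).add ((hε.pow 2).mul ((hexpl.mul_const _).pow 2))
  have := le_of_tendsto_of_tendsto hL hR hkey
  simp only [ne_eq, OfNat.ofNat_ne_zero, not_false_eq_true, zero_pow, zero_mul, zero_div] at this
  nlinarith

/-! ### The monomial weight and its quantitative log-concavity -/

/-- The monomial weight `∏ c xᵢ ^ m`. -/
noncomputable def monomialWeight {n : ℕ} (c : ℝ) (m : ℕ) (x : Fin n → ℝ) : ℝ := ∏ i, (c * x i ^ m)

theorem continuous_monomialWeight {n : ℕ} (c : ℝ) (m : ℕ) :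
    Continuous (monomialWeight c m : (Fin n → ℝ) → ℝ) := by
  unfold monomialWeight; fun_prop

theorem monomialWeight_nonneg {n : ℕ} {c : ℝ} (hc : 0 ≤ c) (m : ℕ) {x : Fin n → ℝ}
    (hx : x ∈ posOrthant n) : 0 ≤ monomialWeight c m x :=
  Finset.prod_nonneg fun i _ => mul_nonneg hc (pow_nonneg (hx i).le _)

/-- In each coordinate `(z + h)(z - h) = z ^ 2 * (1 - s)` with `s = (h / z) ^ 2`, and `(1 - s) ^ m ≤
exp (-m s)`. The exponential factor is the gain that pays for the variation of `g`. -/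
theorem monomialWeight_add_mul_sub_le {n : ℕ} {c : ℝ} (hc : 0 ≤ c) (m : ℕ) {z h : Fin n → ℝ}
    (h1 : z + h ∈ posOrthant n) (h2 : z - h ∈ posOrthant n) :
    monomialWeight c m (z + h) * monomialWeight c m (z - h) ≤
      monomialWeight c m z ^ 2 * Real.exp (-(m * ∑ i, (h i / z i) ^ 2)) := by
  have hz : ∀ i, 0 < z i := fun i => by
    have a := h1 i
    have b := h2 i
    simp only [Pi.add_apply, Pi.sub_apply] at a b
    linarith
  unfold monomialWeight
  rw [Finset.mul_sum, ← Finset.sum_neg_distrib, Real.exp_sum, ← Finset.prod_pow,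
    ← Finset.prod_mul_distrib, ← Finset.prod_mul_distrib]
  refine Finset.prod_le_prod (fun i _ => ?_) fun i _ => ?_
  · exact mul_nonneg (mul_nonneg hc (pow_nonneg (h1 i).le _))
      (mul_nonneg hc (pow_nonneg (h2 i).le _))
  · have a := h1 i
    have b := h2 i
    simp only [Pi.add_apply, Pi.sub_apply] at a b
    have e1 : (z i + h i) * (z i - h i) = z i ^ 2 * (1 - (h i / z i) ^ 2) := by
      have := (hz i).ne'
      field_simp
      ring
    have e2 : 0 ≤ 1 - (h i / z i) ^ 2 := by
      have := mul_pos a b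
      rw [e1] at this
      exact (pos_of_mul_pos_right this (by positivity)).le
    have e3 : (1 - (h i / z i) ^ 2) ^ m ≤ Real.exp (-(m * (h i / z i) ^ 2)) := by
      calc (1 - (h i / z i) ^ 2) ^ m ≤ Real.exp (-(h i / z i) ^ 2) ^ m := by
            gcongr
            linarith [Real.add_one_le_exp (-(h i / z i) ^ 2)]
        _ = _ := by rw [← Real.exp_nat_mul]; ring_nf
    simp only [Pi.add_apply, Pi.sub_apply]
    calc c * (z i + h i) ^ m * (c * (z i - h i) ^ m)
        = c ^ 2 * ((z i + h i) * (z i - h i)) ^ m := by rw [mul_pow]; ring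
      _ = (c * z i ^ m) ^ 2 * (1 - (h i / z i) ^ 2) ^ m := by rw [e1, mul_pow]; ring
      _ ≤ _ := by gcongr

theorem IsOpen.lowerSemicontinuous_indicator_of_continuousOn {X : Type*} [TopologicalSpace X]
    {O : Set X} (hO : IsOpen O) {F : X → ENNReal} (hF : ContinuousOn F O) :
    LowerSemicontinuous (O.indicator F) := by
  rw [lowerSemicontinuous_iff_isOpen_preimage]
  intro a
  have : O.indicator F ⁻¹' Set.Ioi a = O ∩ F ⁻¹' Set.Ioi a := by
    ext x
    by_cases hx : x ∈ O <;> simp [hx]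
  rw [this]
  exact hF.isOpen_inter_preimage hO isOpen_Ioi

/-! ### Penalised difference quotients and their limit -/

/-- The rescaled symmetric difference quotient of `g` in the direction `k`, penalised by the
Hessian of `-m ∑ log zᵢ`. -/
noncomputable def penalizedQuotient {n : ℕ} (m : ℕ) (g : (Fin n → ℝ) → ℝ) (ε : ℝ)
    (k z : Fin n → ℝ) : ℝ :=
  (g (z + ε • k) - g (z - ε • k)) / (2 * ε) - m / 2 * ∑ i, (k i / z i) ^ 2

/-- The points of `U` from which one may step by `± ε • k` inside `U`. -/
def stepSet {n : ℕ} (U : Set (Fin n → ℝ)) (ε : ℝ) (k : Fin n → ℝ) : Set (Fin n → ℝ) :=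
  {z | z + ε • k ∈ U ∧ z - ε • k ∈ U}

/-- The supremum over all admissible directions of the penalised quotient. -/
noncomputable def supPenalizedQuotient {n : ℕ} (m : ℕ) (U : Set (Fin n → ℝ))
    (g : (Fin n → ℝ) → ℝ) (ε : ℝ) (z : Fin n → ℝ) : ENNReal :=
  ⨆ k, (stepSet U ε k).indicator (fun z => ENNReal.ofReal (penalizedQuotient m g ε k z)) z

theorem isOpen_stepSet {n : ℕ} {U : Set (Fin n → ℝ)} (hU : IsOpen U) (ε : ℝ) (k : Fin n → ℝ) :
    IsOpen (stepSet U ε k) :=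
  (hU.preimage (by fun_prop : Continuous fun z => z + ε • k)).inter
    (hU.preimage (by fun_prop : Continuous fun z => z - ε • k))

theorem Convex.mem_of_mem_stepSet {n : ℕ} {U : Set (Fin n → ℝ)} (hU : Convex ℝ U) {ε : ℝ}
    {k z : Fin n → ℝ} (h : z ∈ stepSet U ε k) : z ∈ U := by
  have := hU h.1 h.2 (a := 1 / 2) (b := 1 / 2) (by norm_num) (by norm_num) (by norm_num)
  convert this using 1
  module

/-- The supremum is over uncountably many directions, so measurability goes through lower
semicontinuity, which survives arbitrary suprema. -/
theorem measurable_supPenalizedQuotient {n : ℕ} (m : ℕ) {U : Set (Fin n → ℝ)} (hU : IsOpen U)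
    (hconv : Convex ℝ U) (hpos : U ⊆ posOrthant n) {g : (Fin n → ℝ) → ℝ} (hg : ContinuousOn g U)
    (ε : ℝ) : Measurable (supPenalizedQuotient m U g ε) := by
  refine LowerSemicontinuous.measurable ?_
  refine lowerSemicontinuous_iSup fun k => ?_
  refine (isOpen_stepSet hU ε k).lowerSemicontinuous_indicator_of_continuousOn ?_
  refine ENNReal.continuous_ofReal.comp_continuousOn ?_
  unfold penalizedQuotient
  refine ContinuousOn.sub (ContinuousOn.div_const (ContinuousOn.sub ?_ ?_) _) ?_
  · exact hg.comp (by fun_prop) fun z hz => hz.1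
  · exact hg.comp (by fun_prop) fun z hz => hz.2
  · refine ContinuousOn.const_mul ?_ _
    refine continuousOn_finsetSum _ fun i _ => ?_
    refine (ContinuousOn.div continuousOn_const (by fun_prop) fun z hz => ?_).pow 2
    exact (hpos (hconv.mem_of_mem_stepSet hz) i).ne'

theorem norm_le_mul_sqrt_sum_div {n : ℕ} {R : ℝ} (hR : 0 ≤ R) {z : Fin n → ℝ}
    (hz : z ∈ posOrthant n) (hzR : ∀ i, z i ≤ R) (k : Fin n → ℝ) :
    ‖k‖ ≤ R * √(∑ i, (k i / z i) ^ 2) := by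
  refine (pi_norm_le_iff_of_nonneg (by positivity)).2 fun i => ?_
  have h1 : |k i / z i| ≤ √(∑ i, (k i / z i) ^ 2) := by
    rw [← Real.sqrt_sq_eq_abs]
    exact Real.sqrt_le_sqrt (Finset.single_le_sum (f := fun i => (k i / z i) ^ 2)
      (fun j _ => sq_nonneg _) (Finset.mem_univ i))
  calc ‖k i‖ = z i * |k i / z i| := by
        rw [abs_div, abs_of_pos (hz i), Real.norm_eq_abs]
        field_simp [(hz i).ne']
    _ ≤ R * √(∑ i, (k i / z i) ^ 2) := by
        gcongr
        exact hzR i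

/-- The Lipschitz bound makes the first term linear in the weighted norm of `k`, against a quadratic
penalty. This yields both a bound uniform in `k` and `ε` and the fact that long directions
contribute nothing. -/
theorem penalizedQuotient_le {n m : ℕ} {U : Set (Fin n → ℝ)} {g : (Fin n → ℝ) → ℝ} {L : NNReal}
    (hg : LipschitzOnWith L g U) {R : ℝ} (hR : 0 ≤ R)
    {ε : ℝ} (hε : 0 < ε) {k z : Fin n → ℝ} (hz : z ∈ posOrthant n) (hzR : ∀ i, z i ≤ R)
    (hk : z ∈ stepSet U ε k) :
    penalizedQuotient m g ε k z ≤
      L * R * √(∑ i, (k i / z i) ^ 2) - m / 2 * √(∑ i, (k i / z i) ^ 2) ^ 2 := by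
  have h1 : g (z + ε • k) - g (z - ε • k) ≤ L * (2 * ε * ‖k‖) := by
    refine (le_abs_self _).trans ?_
    have := hg.dist_le_mul _ hk.1 _ hk.2
    rw [Real.dist_eq, dist_eq_norm] at this
    refine this.trans (le_of_eq ?_)
    rw [show z + ε • k - (z - ε • k) = (2 * ε) • k by module, norm_smul, Real.norm_eq_abs,
      abs_of_pos (by positivity)]
  have h2 := norm_le_mul_sqrt_sum_div hR hz hzR k
  unfold penalizedQuotient
  rw [Real.sq_sqrt (Finset.sum_nonneg fun i _ => sq_nonneg _)]
  refine sub_le_sub_right ?_ _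
  rw [div_le_iff₀ (by positivity)]
  refine h1.trans ?_
  calc (L : ℝ) * (2 * ε * ‖k‖) ≤ L * (2 * ε * (R * √(∑ i, (k i / z i) ^ 2))) := by gcongr
    _ = _ := by ring

theorem mul_sub_half_mul_sq_le {a m : ℝ} (hm : 0 < m) (s : ℝ) :
    a * s - m / 2 * s ^ 2 ≤ a ^ 2 / (2 * m) := by
  rw [le_div_iff₀ (by positivity)]
  nlinarith [sq_nonneg (a - m * s)]

theorem supPenalizedQuotient_le {n m : ℕ} (hm : 0 < m) {U : Set (Fin n → ℝ)}
    {g : (Fin n → ℝ) → ℝ} {L : NNReal} (hg : LipschitzOnWith L g U) {R : ℝ} (hR : 0 ≤ R)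
    {ε : ℝ} (hε : 0 < ε) {z : Fin n → ℝ} (hz : z ∈ posOrthant n) (hzR : ∀ i, z i ≤ R) :
    supPenalizedQuotient m U g ε z ≤ ENNReal.ofReal ((L * R) ^ 2 / (2 * m)) := by
  refine iSup_le fun k => ?_
  by_cases hk : z ∈ stepSet U ε k
  · rw [Set.indicator_of_mem hk]
    exact ENNReal.ofReal_le_ofReal ((penalizedQuotient_le hg hR hε hz hzR hk).trans
      (mul_sub_half_mul_sq_le (by exact_mod_cast hm) _))
  · rw [Set.indicator_of_notMem hk]; exact bot_le

-- Directions of weighted norm above `2 L R / m` have a negative quotient. The others lie in a fixed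
-- ball, where the first-order expansion of `g` at `z` is uniform; completing the square in each
-- coordinate then gives the Legendre transform.
open Filter Topology in
theorem eventually_supPenalizedQuotient_le {n m : ℕ} (hm : 0 < m) {U : Set (Fin n → ℝ)}
    {g : (Fin n → ℝ) → ℝ} {L : NNReal} (hg : LipschitzOnWith L g U) {R : ℝ} (hR : 0 < R)
    {z : Fin n → ℝ} (hz : z ∈ posOrthant n) (hzR : ∀ i, z i ≤ R)
    (hd : DifferentiableAt ℝ g z) {δ : ℝ} (hδ : 0 < δ) :
    ∀ᶠ ε in 𝓝[>] (0 : ℝ), supPenalizedQuotient m U g ε z ≤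
      ENNReal.ofReal ((∑ i, (z i * partialDeriv i g z) ^ 2) / (2 * m) + δ) := by
  have hm' : (0 : ℝ) < m := by exact_mod_cast hm
  have hL : (0 : ℝ) ≤ L := L.coe_nonneg
  -- Bounds `‖k‖` for the relevant directions; the `+ 1` keeps it positive when `L = 0`.
  set κ : ℝ := R * (2 * L * R / m) + 1 with hκ
  have hκ0 : 0 < κ := by positivity
  obtain ⟨r, hr, hball⟩ := Metric.eventually_nhds_iff_ball.1
    ((hasFDerivAt_iff_isLittleO.1 hd.hasFDerivAt).bound (div_pos hδ hκ0))
  have hsmall : ∀ᶠ ε in 𝓝[>] (0 : ℝ), ε < r / κ :=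
    nhdsWithin_le_nhds (eventually_lt_nhds (by positivity))
  filter_upwards [hsmall, self_mem_nhdsWithin] with ε hεr hε
  rw [Set.mem_Ioi] at hε
  refine iSup_le fun k => ?_
  by_cases hk : z ∈ stepSet U ε k
  swap
  · rw [Set.indicator_of_notMem hk]; exact bot_le
  rw [Set.indicator_of_mem hk]
  refine ENNReal.ofReal_le_ofReal ?_
  set σ := √(∑ i, (k i / z i) ^ 2) with hσ
  have hσ0 : 0 ≤ σ := Real.sqrt_nonneg _
  have hG : 0 ≤ (∑ i, (z i * partialDeriv i g z) ^ 2) / (2 * m) :=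
    div_nonneg (Finset.sum_nonneg fun i _ => sq_nonneg _) (by positivity)
  have hq := penalizedQuotient_le (m := m) hg hR.le hε hz hzR hk
  rcases le_or_gt σ (2 * L * R / m) with hσs | hσs
  swap
  · refine hq.trans ?_
    have : 2 * L * R < σ * m := (div_lt_iff₀ hm').1 hσs
    nlinarith
  have hkκ : ‖k‖ ≤ κ := by
    refine (norm_le_mul_sqrt_sum_div hR.le hz hzR k).trans ?_
    rw [hκ]
    have : R * σ ≤ R * (2 * L * R / m) := by gcongr
    linarith
  have hεk : ‖ε • k‖ < r := by
    rw [norm_smul, Real.norm_eq_abs, abs_of_pos hε]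
    calc ε * ‖k‖ ≤ ε * κ := by gcongr
      _ < r := (lt_div_iff₀ hκ0).1 hεr
  have hεk' : ‖ε • k‖ ≤ ε * κ := by
    rw [norm_smul, Real.norm_eq_abs, abs_of_pos hε]; gcongr
  have b1 := hball (z + ε • k) (by simpa [dist_eq_norm] using hεk)
  have b2 := hball (z - ε • k) (by simpa [dist_eq_norm] using hεk)
  rw [add_sub_cancel_left, Real.norm_eq_abs] at b1
  rw [sub_sub_cancel_left, norm_neg, Real.norm_eq_abs, map_neg] at b2
  have b3 : δ / κ * ‖ε • k‖ ≤ δ * ε := by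
    calc δ / κ * ‖ε • k‖ ≤ δ / κ * (ε * κ) := by gcongr
      _ = δ * ε := by field_simp
  have b1' := (abs_le.1 (b1.trans b3)).2
  have b2' := (abs_le.1 (b2.trans b3)).1
  have hlin : fderiv ℝ g z (ε • k) = ε * ∑ i, k i * partialDeriv i g z := by
    rw [map_smul, smul_eq_mul]
    congr 1
    conv_lhs => rw [pi_eq_sum_univ' k]
    rw [map_sum]
    refine Finset.sum_congr rfl fun i _ => ?_
    rw [map_smul, smul_eq_mul, partialDeriv, hd.lineDeriv_eq_fderiv]
  rw [hlin] at b1' b2'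
  have hquot : (g (z + ε • k) - g (z - ε • k)) / (2 * ε) ≤
      (∑ i, k i * partialDeriv i g z) + δ := by
    rw [div_le_iff₀ (by positivity)]
    nlinarith
  unfold penalizedQuotient
  have hsum : (∑ i, k i * partialDeriv i g z) - m / 2 * ∑ i, (k i / z i) ^ 2 ≤
      (∑ i, (z i * partialDeriv i g z) ^ 2) / (2 * m) := by
    rw [Finset.mul_sum, ← Finset.sum_sub_distrib, Finset.sum_div]
    refine Finset.sum_le_sum fun i _ => ?_
    refine le_trans (le_of_eq ?_) (mul_sub_half_mul_sq_le hm' (k i / z i))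
    have := (hz i).ne'
    field_simp
  linarith

open Filter Topology in
theorem limsup_supPenalizedQuotient_le {n m : ℕ} (hm : 0 < m) {U : Set (Fin n → ℝ)}
    {g : (Fin n → ℝ) → ℝ} {L : NNReal} (hg : LipschitzOnWith L g U) {R : ℝ} (hR : 0 < R)
    {z : Fin n → ℝ} (hz : z ∈ posOrthant n) (hzR : ∀ i, z i ≤ R)
    (hd : DifferentiableAt ℝ g z) {ε : ℕ → ℝ} (hε : Tendsto ε atTop (𝓝[>] 0)) :
    limsup (fun j => supPenalizedQuotient m U g (ε j) z) atTop ≤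
      ENNReal.ofReal ((∑ i, (z i * partialDeriv i g z) ^ 2) / (2 * m)) := by
  refine ENNReal.le_of_forall_pos_le_add fun δ hδ _ => ?_
  rw [← ENNReal.ofReal_coe_nnreal, ← ENNReal.ofReal_add
    (div_nonneg (Finset.sum_nonneg fun i _ => sq_nonneg _) (by positivity)) δ.coe_nonneg]
  exact limsup_le_of_le (h := hε.eventually
    (eventually_supPenalizedQuotient_le hm hg hR hz hzR hd (by exact_mod_cast hδ)))

/-! ### The weighted measure and Brascamp–Lieb on bounded sets -/

/-- Lebesgue measure on `U` with the density `∏ c xᵢ ^ m`. -/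
noncomputable def monomialMeasure {n : ℕ} (c : ℝ) (m : ℕ) (U : Set (Fin n → ℝ)) :
    Measure (Fin n → ℝ) :=
  (volume.restrict U).withDensity fun x => ENNReal.ofReal (monomialWeight c m x)

theorem measurable_ofReal_monomialWeight {n : ℕ} (c : ℝ) (m : ℕ) :
    Measurable fun x : Fin n → ℝ => ENNReal.ofReal (monomialWeight c m x) :=
  (continuous_monomialWeight c m).measurable.ennreal_ofReal

theorem lintegral_monomialMeasure {n : ℕ} (c : ℝ) (m : ℕ) {U : Set (Fin n → ℝ)}
    (hU : MeasurableSet U) (F : (Fin n → ℝ) → ENNReal) :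
    ∫⁻ x, F x ∂(monomialMeasure c m U) =
      ∫⁻ x, U.indicator (fun x => ENNReal.ofReal (monomialWeight c m x) * F x) x := by
  rw [lintegral_indicator hU, monomialMeasure,
    lintegral_withDensity_eq_lintegral_mul_non_measurable _ (measurable_ofReal_monomialWeight c m)
    (.of_forall fun x => ENNReal.ofReal_lt_top)]
  rfl

theorem ae_monomialMeasure_of_ae {n : ℕ} {c : ℝ} {m : ℕ} {U : Set (Fin n → ℝ)}
    (hU : MeasurableSet U) {p : (Fin n → ℝ) → Prop} (h : ∀ᵐ x, x ∈ U → p x) :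
    ∀ᵐ x ∂(monomialMeasure c m U), p x :=
  (withDensity_absolutelyContinuous _ _).ae_le ((ae_restrict_iff' hU).2 h)

theorem isFiniteMeasure_monomialMeasure {n : ℕ} (c : ℝ) (m : ℕ) {U : Set (Fin n → ℝ)}
    (hU : MeasurableSet U) (hb : Bornology.IsBounded U) :
    IsFiniteMeasure (monomialMeasure c m U) := by
  refine ⟨?_⟩
  have hK := hb.isCompact_closure
  obtain ⟨C, hC⟩ := hK.exists_bound_of_continuousOn
    (continuous_monomialWeight (n := n) c m).continuousOn
  rw [monomialMeasure, withDensity_apply _ MeasurableSet.univ, Measure.restrict_univ]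
  calc ∫⁻ x in U, ENNReal.ofReal (monomialWeight c m x) ≤ ∫⁻ _ in U, ENNReal.ofReal C :=
        setLIntegral_mono' hU fun x hx => ENNReal.ofReal_le_ofReal
          ((le_abs_self _).trans (hC x (subset_closure hx)))
    _ < ⊤ := by
        rw [setLIntegral_const]
        exact ENNReal.mul_lt_top ENNReal.ofReal_lt_top hb.measure_lt_top

/-- For `q ≥ 0` this is `exp s - 1 ≤ s * exp s`. It replaces the exponential by an expression affine
in the positive part of `q`, so that the integral of the supremum itself appears. -/
theorem exp_le_one_add_mul {ε B q : ℝ} (hε : 0 ≤ ε) (hq : q ≤ B) :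
    Real.exp (ε * q) ≤ 1 + ε * Real.exp (ε * B) * max q 0 := by
  rcases le_total q 0 with h | h
  · rw [max_eq_right h, mul_zero, add_zero]
    exact Real.exp_le_one_iff.2 (mul_nonpos_of_nonneg_of_nonpos hε h)
  · rw [max_eq_left h]
    have h1 := Real.add_one_le_exp (-(ε * q))
    have h2 : Real.exp (ε * q) * Real.exp (-(ε * q)) = 1 := by rw [← Real.exp_add]; simp
    have h3 : Real.exp (ε * q) ≤ Real.exp (ε * B) := by gcongr
    have h4 := Real.exp_pos (ε * q)
    have h5 : 0 ≤ ε * q := by positivity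
    nlinarith

theorem exp_moments_le {n m : ℕ} {c : ℝ} (hc : 0 ≤ c) {U : Set (Fin n → ℝ)} (hU : IsOpen U)
    (hconv : Convex ℝ U) (hpos : U ⊆ posOrthant n) {g : (Fin n → ℝ) → ℝ} (hg : ContinuousOn g U)
    {B ε : ℝ} (hε : 0 < ε)
    (hbound : ∀ k, ∀ z ∈ stepSet U ε k, penalizedQuotient m g ε k z ≤ B) :
    (∫⁻ x, ENNReal.ofReal (Real.exp (ε * g x)) ∂(monomialMeasure c m U)) *
      (∫⁻ x, ENNReal.ofReal (Real.exp (-(ε * g x))) ∂(monomialMeasure c m U)) ≤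
    (monomialMeasure c m U Set.univ + ENNReal.ofReal (ε ^ 2 * Real.exp (ε ^ 2 * B)) *
      ∫⁻ x, supPenalizedQuotient m U g ε x ∂(monomialMeasure c m U)) ^ 2 := by
  have hQ := measurable_supPenalizedQuotient m hU hconv hpos hg ε
  set a := ENNReal.ofReal (ε ^ 2 * Real.exp (ε ^ 2 * B)) with ha
  have hR : monomialMeasure c m U Set.univ +
      a * ∫⁻ x, supPenalizedQuotient m U g ε x ∂(monomialMeasure c m U) =
      ∫⁻ x, (1 + a * supPenalizedQuotient m U g ε x) ∂(monomialMeasure c m U) := by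
    rw [lintegral_add_left measurable_const, lintegral_const_mul _ hQ]
    simp
  have hρ := continuous_monomialWeight (n := n) c m
  have hmeas : ∀ s : ℝ, Measurable (U.indicator fun x => ENNReal.ofReal (monomialWeight c m x) *
      ENNReal.ofReal (Real.exp (s * g x))) := fun s => by
    simp only [← ENNReal.ofReal_mul' (Real.exp_pos _).le]
    refine (hU.lowerSemicontinuous_indicator_of_continuousOn ?_).measurable
    exact ENNReal.continuous_ofReal.comp_continuousOn (hρ.continuousOn.mul
      (Real.continuous_exp.comp_continuousOn (hg.const_mul s)))
  rw [hR]
  simp only [← neg_mul]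
  rw [lintegral_monomialMeasure _ _ hU.measurableSet, lintegral_monomialMeasure _ _ hU.measurableSet,
    lintegral_monomialMeasure _ _ hU.measurableSet]
  refine prekopaLeindler (hmeas _) (hmeas _) (((measurable_ofReal_monomialWeight c m).mul
    (measurable_const.add (hQ.const_mul a))).indicator hU.measurableSet) fun x y => ?_
  by_cases hx : x ∈ U
  swap
  · simp [Set.indicator_of_notMem hx]
  by_cases hy : y ∈ U
  swap
  · simp [Set.indicator_of_notMem hy]
  set z := (1 / 2 : ℝ) • (x + y) with hz
  -- Chosen so that `x = z + ε • k` and `y = z - ε • k` about the midpoint `z`.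
  set k := (1 / (2 * ε)) • (x - y) with hk
  have hεk : ε • k = (1 / 2 : ℝ) • (x - y) := by
    rw [hk, smul_smul]; congr 1; field_simp
  have hxz : x = z + ε • k := by rw [hεk, hz]; module
  have hyz : y = z - ε • k := by rw [hεk, hz]; module
  have hzk : z ∈ stepSet U ε k := ⟨hxz ▸ hx, hyz ▸ hy⟩
  have hzU : z ∈ U := hconv.mem_of_mem_stepSet hzk
  have hqB := hbound k z hzk
  have hweight := monomialWeight_add_mul_sub_le hc m (hpos hzk.1) (hpos hzk.2)
  have hqsup : ENNReal.ofReal (penalizedQuotient m g ε k z) ≤ supPenalizedQuotient m U g ε z := by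
    refine le_iSup_of_le k ?_
    rw [Set.indicator_of_mem hzk]
  set q := penalizedQuotient m g ε k z with hq
  -- The penalty in `q` is calibrated so that this last sum cancels exactly against the
  -- log-concavity gain of the weight.
  have hqeq : ε * g x + -ε * g y = 2 * (ε ^ 2 * q) + m * ∑ i, ((ε • k) i / z i) ^ 2 := by
    have : ∑ i, ((ε • k) i / z i) ^ 2 = ε ^ 2 * ∑ i, (k i / z i) ^ 2 := by
      rw [Finset.mul_sum]
      refine Finset.sum_congr rfl fun i _ => ?_
      simp only [Pi.smul_apply, smul_eq_mul]
      ring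
    rw [this, hq, penalizedQuotient, ← hxz, ← hyz]
    field_simp
    ring
  have hwx := monomialWeight_nonneg hc m (hpos hx)
  have hwy := monomialWeight_nonneg hc m (hpos hy)
  have hwz := monomialWeight_nonneg hc m (hpos hzU)
  rw [← hxz, ← hyz] at hweight
  rw [Set.indicator_of_mem hx, Set.indicator_of_mem hy, Set.indicator_of_mem hzU]
  have hreal : monomialWeight c m x * Real.exp (ε * g x) *
      (monomialWeight c m y * Real.exp (-ε * g y)) ≤
      (monomialWeight c m z * (1 + ε ^ 2 * Real.exp (ε ^ 2 * B) * max q 0)) ^ 2 := by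
    calc _ = monomialWeight c m x * monomialWeight c m y * Real.exp (ε * g x + -ε * g y) := by
          rw [Real.exp_add]; ring
      _ ≤ monomialWeight c m z ^ 2 * Real.exp (-(m * ∑ i, ((ε • k) i / z i) ^ 2)) *
          Real.exp (ε * g x + -ε * g y) := by gcongr
      _ = (monomialWeight c m z * Real.exp (ε ^ 2 * q)) ^ 2 := by
          rw [mul_assoc, ← Real.exp_add, hqeq, mul_pow, ← Real.exp_nat_mul]
          congr 2
          push_cast
          ring
      _ ≤ _ := by
          gcongr
          exact exp_le_one_add_mul (by positivity) hqB
  rw [← ENNReal.ofReal_mul hwx, ← ENNReal.ofReal_mul hwy, ← ENNReal.ofReal_mul (by positivity)]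
  refine (ENNReal.ofReal_le_ofReal hreal).trans ?_
  rw [ENNReal.ofReal_pow (by positivity), ENNReal.ofReal_mul hwz,
    ENNReal.ofReal_add zero_le_one (by positivity), ENNReal.ofReal_one,
    ENNReal.ofReal_mul (q := max q 0) (by positivity), ENNReal.ofReal_max, ENNReal.ofReal_zero,
    max_eq_left zero_le]
  gcongr

open Filter Topology in
/-- The Brascamp–Lieb inequality for the weight `∏ c xᵢ ^ m` restricted to a bounded open convex
set, for Lipschitz functions with zero mean. -/
theorem brascampLieb_of_integral_eq_zero {n m : ℕ} (hm : 0 < m) {c : ℝ} (hc : 0 ≤ c)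
    {U : Set (Fin n → ℝ)} (hU : IsOpen U) (hconv : Convex ℝ U) (hpos : U ⊆ posOrthant n)
    (hbdd : Bornology.IsBounded U) {g : (Fin n → ℝ) → ℝ} {L : NNReal}
    (hg : LipschitzOnWith L g U) (h0 : ∫ x, g x ∂(monomialMeasure c m U) = 0) :
    ∫⁻ x, ENNReal.ofReal (g x ^ 2) ∂(monomialMeasure c m U) ≤
      ∫⁻ x, ENNReal.ofReal ((∑ i, (x i * partialDeriv i g x) ^ 2) / m)
        ∂(monomialMeasure c m U) := by
  have := isFiniteMeasure_monomialMeasure c m hU.measurableSet hbdd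
  obtain ⟨R, hR, hUR⟩ := hbdd.exists_pos_norm_le
  have hUR' : ∀ z ∈ U, ∀ i, z i ≤ R := fun z hz i =>
    (le_abs_self _).trans ((norm_le_pi_norm z i).trans (hUR z hz))
  obtain ⟨C, hC⟩ : ∃ C, ∀ x ∈ U, |g x| ≤ C := by
    rcases U.eq_empty_or_nonempty with rfl | ⟨y, hy⟩
    · exact ⟨0, by simp⟩
    refine ⟨|g y| + L * (R + R), fun x hx => ?_⟩
    have h1 := hg.dist_le_mul x hx y hy
    have h2 : dist x y ≤ R + R := (dist_le_norm_add_norm x y).trans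
      (add_le_add (hUR x hx) (hUR y hy))
    have h3 : |g x| - |g y| ≤ |g x - g y| := abs_sub_abs_le_abs_sub _ _
    rw [Real.dist_eq] at h1
    have h4 : (L : ℝ) * dist x y ≤ L * (R + R) := by gcongr
    linarith
  set ε : ℕ → ℝ := fun j => 1 / ((j : ℝ) + 1) with hεdef
  have hε0 : ∀ j, 0 < ε j := fun j => by positivity
  have hε : Tendsto ε atTop (𝓝 0) := tendsto_one_div_add_atTop_nhds_zero_nat
  have hε' : Tendsto ε atTop (𝓝[>] 0) :=
    tendsto_nhdsWithin_iff.2 ⟨hε, .of_forall fun j => hε0 j⟩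
  have hm' : (0 : ℝ) < m := by exact_mod_cast hm
  have key := lintegral_sq_le_of_exp_moments (μ := monomialMeasure c m U) (g := g) (C := C)
    (B := (L * R) ^ 2 / (2 * m))
    (Q := fun j => supPenalizedQuotient m U g (ε j))
    (q := fun z => ENNReal.ofReal ((∑ i, (z i * partialDeriv i g z) ^ 2) / (2 * m)))
    ((hg.continuousOn.aestronglyMeasurable hU.measurableSet).mono_ac
      (withDensity_absolutelyContinuous _ _))
    (ae_monomialMeasure_of_ae hU.measurableSet (.of_forall hC)) h0 hε0 hε
    (fun j => measurable_supPenalizedQuotient m hU hconv hpos hg.continuousOn _)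
    (fun j => ae_monomialMeasure_of_ae hU.measurableSet (.of_forall fun x hx =>
      supPenalizedQuotient_le hm hg hR.le (hε0 j) (hpos hx) (hUR' x hx)))
    (ae_monomialMeasure_of_ae hU.measurableSet (by
      filter_upwards [hg.ae_differentiableWithinAt_of_mem] with x hx hxU
      exact limsup_supPenalizedQuotient_le hm hg hR (hpos hxU) (hUR' x hxU)
        ((hx hxU).differentiableAt (hU.mem_nhds hxU)) hε'))
    (fun j => exp_moments_le hc hU hconv hpos hg.continuousOn (hε0 j)
      fun k z hz => (penalizedQuotient_le hg hR.le (hε0 j)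
        (hpos (hconv.mem_of_mem_stepSet hz)) (hUR' z (hconv.mem_of_mem_stepSet hz)) hz).trans
        (mul_sub_half_mul_sq_le hm' _))
  refine key.trans ?_
  rw [← lintegral_const_mul' _ _ (by simp)]
  refine lintegral_mono fun x => le_of_eq ?_
  rw [show (2 : ENNReal) = ENNReal.ofReal 2 by simp, ← ENNReal.ofReal_mul (by norm_num)]
  congr 1
  field_simp

-- Obtained by centring `g`. The extra term is the squared mean contribution, needed because a
-- function of zero mean on the whole set need not have zero mean on the pieces of an exhaustion.
open Filter Topology in
theorem brascampLieb_of_lipschitzOnWith {n m : ℕ} (hm : 0 < m) {c : ℝ} (hc : 0 ≤ c)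
    {U : Set (Fin n → ℝ)} (hU : IsOpen U) (hconv : Convex ℝ U) (hpos : U ⊆ posOrthant n)
    (hbdd : Bornology.IsBounded U) {g : (Fin n → ℝ) → ℝ} {L : NNReal}
    (hg : LipschitzOnWith L g U) (hgi : Integrable g (monomialMeasure c m U)) :
    ∫⁻ x, ENNReal.ofReal (g x ^ 2) ∂(monomialMeasure c m U) ≤
      ∫⁻ x, ENNReal.ofReal ((∑ i, (x i * partialDeriv i g x) ^ 2) / m)
        ∂(monomialMeasure c m U) +
      ENNReal.ofReal ((∫ x, g x ∂(monomialMeasure c m U)) ^ 2 /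
        (monomialMeasure c m U).real Set.univ) := by
  set μ := monomialMeasure c m U with hμ
  have := isFiniteMeasure_monomialMeasure c m hU.measurableSet hbdd
  rw [← hμ] at this
  rcases eq_or_ne μ 0 with h | h
  · simp [h]
  have hM : 0 < μ.real Set.univ := by
    rw [measureReal_def]
    exact ENNReal.toReal_pos (by simpa using h) (measure_ne_top _ _)
  set M := μ.real Set.univ with hMdef
  set a := (∫ x, g x ∂μ) / M with ha
  have hIa : ∫ x, g x ∂μ = M * a := by rw [ha]; field_simp
  have hLa : LipschitzOnWith L (fun x => g x - a) U := fun x hx y hy => by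
    simpa [edist_sub_right] using hg hx hy
  have h0 : ∫ x, (g x - a) ∂μ = 0 := by
    rw [integral_sub hgi (integrable_const _), hIa]; simp [hMdef]
  have key := brascampLieb_of_integral_eq_zero hm hc hU hconv hpos hbdd hLa h0
  have hpd : ∀ i x, partialDeriv i (fun x => g x - a) x = partialDeriv i g x := fun i x => by
    simp only [partialDeriv, lineDeriv, deriv_sub_const]
  simp only [hpd] at key
  refine le_trans ?_ (add_le_add_left key _)
  by_cases hs : Integrable (fun x => (g x - a) ^ 2) μ
  · have hs2 : ∀ x, g x ^ 2 = (g x - a) ^ 2 + (2 * a * g x - a ^ 2) := fun x => by ring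
    have i2 : Integrable (fun x => 2 * a * g x - a ^ 2) μ :=
      (hgi.const_mul _).sub (integrable_const _)
    have hg2 : Integrable (fun x => g x ^ 2) μ := by
      simp only [hs2]; exact hs.add i2
    rw [← ofReal_integral_eq_lintegral_ofReal hs (.of_forall fun x => sq_nonneg _),
      ← ofReal_integral_eq_lintegral_ofReal hg2 (.of_forall fun x => sq_nonneg _),
      ← ENNReal.ofReal_add (integral_nonneg fun x => sq_nonneg _) (by positivity)]
    refine ENNReal.ofReal_le_ofReal (le_of_eq ?_)
    simp only [hs2]
    rw [integral_add hs i2, integral_sub (hgi.const_mul _) (integrable_const _),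
      integral_const_mul, hIa]
    simp only [integral_const, smul_eq_mul, ← hMdef]
    field_simp
    ring
  -- Without square integrability the right side is infinite.
  · have htop : ∫⁻ x, ENNReal.ofReal ((g x - a) ^ 2) ∂μ = ⊤ := by
      by_contra hc
      refine hs ⟨((hgi.aestronglyMeasurable.sub aestronglyMeasurable_const).pow 2), ?_⟩
      rw [hasFiniteIntegral_iff_ofReal (.of_forall fun x => sq_nonneg _)]
      exact lt_top_iff_ne_top.2 hc
    rw [htop]
    simp

/-! ### Exhaustion, and Brascamp–Lieb on open convex sets -/

/-- If `w` is closer to `a • x + b • y` than both `x` and `y` are to the complement, translating `x`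
and `y` by `w - (a • x + b • y)` stays in `V`, and the same convex combination of the translates is
`w`. -/
theorem Convex.setOf_lt_infEDist_compl {E : Type*} [NormedAddCommGroup E] [NormedSpace ℝ E]
    {V : Set E} (hV : Convex ℝ V) (δ : ENNReal) : Convex ℝ {x | δ < Metric.infEDist x Vᶜ} := by
  intro x hx y hy a b ha hb hab
  simp only [Set.mem_ofPred_eq] at *
  refine lt_of_lt_of_le (lt_min hx hy) (Metric.le_infEDist.2 fun w hw => ?_)
  by_contra hlt
  rw [not_le, lt_min_iff] at hlt
  have step : ∀ p : E, edist (a • x + b • y) w < Metric.infEDist p Vᶜ →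
      p + (w - (a • x + b • y)) ∈ V := by
    intro p hp
    by_contra hpn
    refine absurd (Metric.infEDist_le_edist_of_mem hpn) (not_le.2 (lt_of_eq_of_lt ?_ hp))
    rw [edist_comm, edist_eq_enorm_sub, edist_comm, edist_eq_enorm_sub, add_sub_cancel_left]
  refine hw ?_
  convert hV (step x hlt.1) (step y hlt.2) ha hb hab using 1
  have : w = (a + b) • w := by rw [hab, one_smul]
  rw [smul_add, smul_add, add_add_add_comm, ← add_smul, hab, one_smul]
  abel

theorem Convex.exists_exhaustion {n : ℕ} {V : Set (Fin n → ℝ)} (hV : IsOpen V)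
    (hconv : Convex ℝ V) : ∃ U : ℕ → Set (Fin n → ℝ), Monotone U ∧ (∀ j, IsOpen (U j)) ∧
      (∀ j, Convex ℝ (U j)) ∧ (∀ j, Bornology.IsBounded (U j)) ∧ (∀ j, closure (U j) ⊆ V) ∧
      ⋃ j, U j = V := by
  refine ⟨fun j => {x | ((j : ENNReal) + 1)⁻¹ < Metric.infEDist x Vᶜ} ∩ Metric.ball 0 j,
    ?_, fun j => ?_, fun j => ?_, fun j => ?_, fun j => ?_, ?_⟩
  · intro i j hij x hx
    refine ⟨Set.mem_ofPred_eq ▸ lt_of_le_of_lt ?_ (Set.mem_ofPred_eq ▸ hx.1),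
      Metric.ball_subset_ball (by exact_mod_cast hij) hx.2⟩
    gcongr
  · exact (isOpen_lt continuous_const Metric.continuous_infEDist).inter Metric.isOpen_ball
  · exact (hconv.setOf_lt_infEDist_compl _).inter (convex_ball _ _)
  · exact Metric.isBounded_ball.subset Set.inter_subset_right
  · refine (closure_mono Set.inter_subset_left).trans ?_
    refine (closure_lt_subset_le continuous_const Metric.continuous_infEDist).trans fun x hx => ?_
    by_contra hxV
    have h0 : Metric.infEDist x Vᶜ = 0 := Metric.infEDist_zero_of_mem hxV
    simp [h0] at hx
  · ext x
    simp only [Set.mem_iUnion]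
    constructor
    · rintro ⟨j, hj, -⟩
      by_contra hxV
      have h0 : Metric.infEDist x Vᶜ = 0 := Metric.infEDist_zero_of_mem hxV
      simp [h0] at hj
    · intro hx
      have h1 : 0 < Metric.infEDist x Vᶜ := by
        rw [pos_iff_ne_zero, ne_eq, ← Metric.mem_iff_infEDist_zero_of_closed hV.isClosed_compl]
        simpa using hx
      obtain ⟨N, hN⟩ := ENNReal.exists_inv_nat_lt h1.ne'
      obtain ⟨N', hN'⟩ := exists_nat_gt ‖x‖
      refine ⟨max N N', lt_of_le_of_lt ?_ hN, ?_⟩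
      · rw [ENNReal.inv_le_inv]
        exact le_trans (by exact_mod_cast le_max_left _ _) le_self_add
      · rw [mem_ball_zero_iff]
        exact hN'.trans_le (by exact_mod_cast le_max_right _ _)

/-- The pieces have compact closure inside `V`, where a locally Lipschitz function is Lipschitz. -/
theorem LocallyLipschitzOn.exists_exhaustion {n : ℕ} {V : Set (Fin n → ℝ)} (hV : IsOpen V)
    (hconv : Convex ℝ V) {g : (Fin n → ℝ) → ℝ} (hg : LocallyLipschitzOn V g) :
    ∃ U : ℕ → Set (Fin n → ℝ), Monotone U ∧ (∀ j, IsOpen (U j)) ∧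
      (∀ j, Convex ℝ (U j)) ∧ (∀ j, Bornology.IsBounded (U j)) ∧
      (∀ j, ∃ L, LipschitzOnWith L g (U j)) ∧ ⋃ j, U j = V := by
  obtain ⟨U, h1, h2, h3, h4, h5, h6⟩ := hconv.exists_exhaustion hV
  refine ⟨U, h1, h2, h3, h4, fun j => ?_, h6⟩
  obtain ⟨L, hL⟩ := (hg.mono (h5 j)).exists_lipschitzOnWith_of_compact (h4 j).isCompact_closure
  exact ⟨L, hL.mono subset_closure⟩

theorem LocallyLipschitzOn.ae_differentiableAt_of_convex {n : ℕ} {V : Set (Fin n → ℝ)}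
    (hV : IsOpen V) (hconv : Convex ℝ V) {g : (Fin n → ℝ) → ℝ} (hg : LocallyLipschitzOn V g) :
    ∀ᵐ x, x ∈ V → DifferentiableAt ℝ g x := by
  obtain ⟨U, -, hUo, -, -, hL, hUV⟩ := hg.exists_exhaustion hV hconv
  have : ∀ᵐ x, ∀ j, x ∈ U j → DifferentiableAt ℝ g x := by
    refine ae_all_iff.2 fun j => ?_
    obtain ⟨L, hL⟩ := hL j
    filter_upwards [hL.ae_differentiableWithinAt_of_mem] with x hx hxU
    exact (hx hxU).differentiableAt ((hUo j).mem_nhds hxU)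
  filter_upwards [this] with x hx hxV
  rw [← hUV, Set.mem_iUnion] at hxV
  obtain ⟨j, hj⟩ := hxV
  exact hx j hj

theorem monomialMeasure_restrict {n : ℕ} (c : ℝ) (m : ℕ) {U V : Set (Fin n → ℝ)}
    (hU : MeasurableSet U) (hUV : U ⊆ V) :
    (monomialMeasure c m V).restrict U = monomialMeasure c m U := by
  rw [monomialMeasure, restrict_withDensity hU, Measure.restrict_restrict hU,
    Set.inter_eq_left.2 hUV]
  rfl

theorem monomialMeasure_univ_pos {n : ℕ} {c : ℝ} (hc : 0 < c) (m : ℕ) {U : Set (Fin n → ℝ)}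
    (hU : IsOpen U) (hpos : U ⊆ posOrthant n) (hne : U.Nonempty) :
    0 < monomialMeasure c m U Set.univ := by
  rw [monomialMeasure, withDensity_apply _ MeasurableSet.univ, Measure.restrict_univ,
    setLIntegral_pos_iff (measurable_ofReal_monomialWeight c m)]
  refine (hU.measure_pos volume hne).trans_le (measure_mono fun x hx => ⟨?_, hx⟩)
  rw [Function.mem_support]
  exact (ENNReal.ofReal_pos.2 (Finset.prod_pos fun i _ =>
    mul_pos hc (pow_pos (hpos hx i) _))).ne'

open Filter Topology in
/-- The Brascamp–Lieb inequality for the weight `∏ c xᵢ ^ m` on an open convex set. -/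
theorem brascampLieb_monomialMeasure {n m : ℕ} (hm : 0 < m) {c : ℝ} (hc : 0 < c)
    {V : Set (Fin n → ℝ)} (hV : IsOpen V) (hconv : Convex ℝ V) (hpos : V ⊆ posOrthant n)
    {g : (Fin n → ℝ) → ℝ} (hg : LocallyLipschitzOn V g)
    (hgi : Integrable g (monomialMeasure c m V)) (h0 : ∫ x, g x ∂(monomialMeasure c m V) = 0) :
    ∫⁻ x, ENNReal.ofReal (g x ^ 2) ∂(monomialMeasure c m V) ≤
      ∫⁻ x, ENNReal.ofReal ((∑ i, (x i * partialDeriv i g x) ^ 2) / m)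
        ∂(monomialMeasure c m V) := by
  rcases V.eq_empty_or_nonempty with rfl | hne
  · simp [monomialMeasure]
  obtain ⟨U, hmono, hUo, hUc, hUb, hL, hUV⟩ := hg.exists_exhaustion hV hconv
  have hsub : ∀ j, U j ⊆ V := fun j => hUV ▸ Set.subset_iUnion U j
  set μ := monomialMeasure c m V with hμ
  have hμV : μ.restrict V = μ := by
    rw [hμ, monomialMeasure_restrict c m hV.measurableSet subset_rfl]
  have hres : ∀ j, μ.restrict (U j) = monomialMeasure c m (U j) := fun j =>
    monomialMeasure_restrict c m (hUo j).measurableSet (hsub j)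
  obtain ⟨N, hN⟩ : ∃ N, (U N).Nonempty := by
    rw [← hUV] at hne
    exact Set.nonempty_iUnion.1 hne
  have hfin : ∀ j, μ (U j) ≠ ⊤ := fun j => by
    have := isFiniteMeasure_monomialMeasure c m (hUo j).measurableSet (hUb j)
    have h := measure_ne_top (monomialMeasure c m (U j)) Set.univ
    rwa [← hres, Measure.restrict_apply_univ] at h
  have hMN : 0 < μ.real (U N) := by
    rw [measureReal_def]
    refine ENNReal.toReal_pos ?_ (hfin N)
    have := monomialMeasure_univ_pos hc m (hUo N) ((hsub N).trans hpos) hN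
    rwa [← hres, Measure.restrict_apply_univ, pos_iff_ne_zero] at this
  set D := ∫⁻ x, ENNReal.ofReal ((∑ i, (x i * partialDeriv i g x) ^ 2) / m) ∂μ with hD
  -- The denominator is frozen at the fixed nonempty piece `U N`, so the correction vanishes as soon
  -- as the means over `U j` tend to 0; `V` may have infinite mass.
  have hstep : ∀ j ≥ N, ∫⁻ x in U j, ENNReal.ofReal (g x ^ 2) ∂μ ≤
      D + ENNReal.ofReal ((∫ x in U j, g x ∂μ) ^ 2 / μ.real (U N)) := by
    intro j hj
    obtain ⟨L, hLj⟩ := hL j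
    have := brascampLieb_of_lipschitzOnWith hm hc.le (hUo j) (hUc j) ((hsub j).trans hpos) (hUb j)
      hLj (by rw [← hres]; exact hgi.restrict)
    rw [← hres] at this
    refine this.trans (add_le_add (setLIntegral_le_lintegral _ _) (ENNReal.ofReal_le_ofReal ?_))
    gcongr
    rw [measureReal_restrict_apply_univ]
    exact measureReal_mono (hmono hj) (hfin j)
  have hlim1 : Tendsto (fun j => ∫⁻ x in U j, ENNReal.ofReal (g x ^ 2) ∂μ) atTop
      (𝓝 (∫⁻ x, ENNReal.ofReal (g x ^ 2) ∂μ)) := by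
    have e : ∫⁻ x, ENNReal.ofReal (g x ^ 2) ∂μ = ⨆ j, ∫⁻ x in U j, ENNReal.ofReal (g x ^ 2) ∂μ := by
      rw [← setLIntegral_iUnion_of_directed _ hmono.directed_le, hUV, hμV]
    rw [e]
    exact tendsto_atTop_iSup fun i j hij => lintegral_mono_set (hmono hij)
  have hlim2 : Tendsto (fun j => ∫ x in U j, g x ∂μ) atTop (𝓝 0) := by
    have := tendsto_setIntegral_of_monotone (fun j => (hUo j).measurableSet) hmono
      (hgi.integrableOn (s := ⋃ j, U j))
    rwa [hUV, hμV, h0] at this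
  have hlim3 : Tendsto (fun j => D + ENNReal.ofReal ((∫ x in U j, g x ∂μ) ^ 2 / μ.real (U N)))
      atTop (𝓝 D) := by
    have := (ENNReal.tendsto_ofReal ((hlim2.pow 2).div_const (μ.real (U N)))).const_add D
    simpa using this
  exact le_of_tendsto_of_tendsto hlim1 hlim3 ((eventually_ge_atTop N).mono hstep)

theorem brascampLieb_monomialMeasure_sum {n m : ℕ} (hm : 0 < m) {c : ℝ} (hc : 0 < c)
    {V : Set (Fin n → ℝ)} (hV : IsOpen V) (hconv : Convex ℝ V) (hpos : V ⊆ posOrthant n)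
    {g : (Fin n → ℝ) → ℝ} (hg : LocallyLipschitzOn V g)
    (hgi : Integrable g (monomialMeasure c m V)) (h0 : ∫ x, g x ∂(monomialMeasure c m V) = 0) :
    ∫⁻ x, ENNReal.ofReal (g x ^ 2) ∂(monomialMeasure c m V) ≤
      ENNReal.ofReal (1 / m) * ∑ i, ∫⁻ x, ENNReal.ofReal ((x i * partialDeriv i g x) ^ 2)
        ∂(monomialMeasure c m V) := by
  refine (brascampLieb_monomialMeasure hm hc hV hconv hpos hg hgi h0).trans (le_of_eq ?_)
  rw [← lintegral_finsetSum', ← lintegral_const_mul' _ _ ENNReal.ofReal_ne_top]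
  · refine lintegral_congr fun x => ?_
    rw [← ENNReal.ofReal_sum_of_nonneg fun i _ => sq_nonneg _, ← ENNReal.ofReal_mul (by positivity)]
    congr 1
    ring
  · intro i _
    -- `fderiv` is measurable for every `g`, and agrees almost everywhere with the partial
    -- derivative by Rademacher.
    have hF : Measurable fun x => ENNReal.ofReal ((x i * fderiv ℝ g x (Pi.single i 1)) ^ 2) := by
      have := (measurable_fderiv ℝ g).apply_continuousLinearMap (Pi.single i 1)
      fun_prop
    refine hF.aemeasurable.congr (ae_monomialMeasure_of_ae hV.measurableSet ?_)
    filter_upwards [hg.ae_differentiableAt_of_convex hV hconv] with x hx hxV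
    rw [partialDeriv, (hx hxV).lineDeriv_eq_fderiv]

/-! ### The power change of variables -/

/-- The coordinatewise power map. -/
def coordPow {n : ℕ} (ℓ : ℕ) (y : Fin n → ℝ) : Fin n → ℝ := fun i => y i ^ ℓ

/-- The derivative of the coordinatewise power map. -/
noncomputable def coordPowDeriv {n : ℕ} (ℓ : ℕ) (y : Fin n → ℝ) :
    (Fin n → ℝ) →L[ℝ] (Fin n → ℝ) :=
  ContinuousLinearMap.pi fun i =>
    (((ℓ : ℝ) * y i ^ (ℓ - 1)) • ContinuousLinearMap.id ℝ ℝ) ∘SL ContinuousLinearMap.proj i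

theorem hasFDerivAt_coordPow {n : ℕ} (ℓ : ℕ) (y : Fin n → ℝ) :
    HasFDerivAt (coordPow ℓ) (coordPowDeriv ℓ y) y := by
  refine hasFDerivAt_pi.2 fun i => ?_
  have h1 : HasFDerivAt (fun x : Fin n → ℝ => x i) (ContinuousLinearMap.proj i) y :=
    (ContinuousLinearMap.proj (R := ℝ) (φ := fun _ : Fin n => ℝ) i).hasFDerivAt
  refine ((hasDerivAt_pow ℓ (y i)).comp_hasFDerivAt y h1).congr_fderiv ?_
  ext v
  simp

theorem abs_det_coordPowDeriv {n : ℕ} (ℓ : ℕ) {y : Fin n → ℝ} (hy : y ∈ posOrthant n) :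
    |(coordPowDeriv ℓ y).det| = monomialWeight ℓ (ℓ - 1) y := by
  have : (coordPowDeriv ℓ y).det = monomialWeight ℓ (ℓ - 1) y := by
    rw [coordPowDeriv, ContinuousLinearMap.det_pi, monomialWeight]
    refine Finset.prod_congr rfl fun i _ => ?_
    simp [ContinuousLinearMap.det]
  rw [this, abs_of_nonneg (monomialWeight_nonneg (Nat.cast_nonneg ℓ) _ hy)]

theorem injOn_coordPow {n ℓ : ℕ} (hℓ : ℓ ≠ 0) : Set.InjOn (coordPow ℓ) (posOrthant n) :=
  fun _ hx _ hy h => funext fun i =>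
    (pow_left_inj₀ (hx i).le (hy i).le hℓ).1 (congrFun h i)

theorem lintegral_image_coordPow {n ℓ : ℕ} (hℓ : ℓ ≠ 0) {V : Set (Fin n → ℝ)}
    (hV : MeasurableSet V) (hpos : V ⊆ posOrthant n) (F : (Fin n → ℝ) → ENNReal) :
    ∫⁻ x in coordPow ℓ '' V, F x = ∫⁻ y, F (coordPow ℓ y) ∂(monomialMeasure ℓ (ℓ - 1) V) := by
  rw [lintegral_image_eq_lintegral_abs_det_fderiv_mul volume hV
    (fun y _ => (hasFDerivAt_coordPow ℓ y).hasFDerivWithinAt) ((injOn_coordPow hℓ).mono hpos),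
    lintegral_monomialMeasure _ _ hV, lintegral_indicator hV]
  exact setLIntegral_congr_fun hV fun y hy => by rw [abs_det_coordPowDeriv ℓ (hpos hy)]

theorem toReal_monomialWeight_smul {n ℓ : ℕ} {y : Fin n → ℝ} (hy : y ∈ posOrthant n) (a : ℝ) :
    (ENNReal.ofReal (monomialWeight ℓ (ℓ - 1) y)).toReal • a = |(coordPowDeriv ℓ y).det| • a := by
  rw [abs_det_coordPowDeriv ℓ hy,
    ENNReal.toReal_ofReal (monomialWeight_nonneg (Nat.cast_nonneg ℓ) _ hy)]

theorem integral_image_coordPow {n ℓ : ℕ} (hℓ : ℓ ≠ 0) {V : Set (Fin n → ℝ)}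
    (hV : MeasurableSet V) (hpos : V ⊆ posOrthant n) (f : (Fin n → ℝ) → ℝ) :
    ∫ x in coordPow ℓ '' V, f x = ∫ y, f (coordPow ℓ y) ∂(monomialMeasure ℓ (ℓ - 1) V) := by
  rw [integral_image_eq_integral_abs_det_fderiv_smul volume hV
    (fun y _ => (hasFDerivAt_coordPow ℓ y).hasFDerivWithinAt) ((injOn_coordPow hℓ).mono hpos),
    monomialMeasure, integral_withDensity_eq_integral_toReal_smul
      (measurable_ofReal_monomialWeight _ _) (.of_forall fun _ => ENNReal.ofReal_lt_top)]
  exact setIntegral_congr_fun hV fun y hy => (toReal_monomialWeight_smul (hpos hy) _).symm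

theorem integrableOn_image_coordPow {n ℓ : ℕ} (hℓ : ℓ ≠ 0) {V : Set (Fin n → ℝ)}
    (hV : MeasurableSet V) (hpos : V ⊆ posOrthant n) {f : (Fin n → ℝ) → ℝ}
    (hf : IntegrableOn f (coordPow ℓ '' V)) :
    Integrable (fun y => f (coordPow ℓ y)) (monomialMeasure ℓ (ℓ - 1) V) := by
  rw [integrableOn_image_iff_integrableOn_abs_det_fderiv_smul volume hV
    (fun y _ => (hasFDerivAt_coordPow ℓ y).hasFDerivWithinAt)
    ((injOn_coordPow hℓ).mono hpos)] at hf
  rw [monomialMeasure, integrable_withDensity_iff_integrable_smul'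
    (measurable_ofReal_monomialWeight _ _) (.of_forall fun _ => ENNReal.ofReal_lt_top)]
  exact hf.congr_fun (fun y hy => (toReal_monomialWeight_smul (hpos hy) _).symm) hV

theorem coordPow_mem_posOrthant {n : ℕ} (ℓ : ℕ) {y : Fin n → ℝ} (hy : y ∈ posOrthant n) :
    coordPow ℓ y ∈ posOrthant n := fun i => pow_pos (hy i) _

theorem isOpen_posOrthant (n : ℕ) : IsOpen (posOrthant n) := by
  have : posOrthant n = ⋂ i, {x : Fin n → ℝ | 0 < x i} := by ext; simp [posOrthant]
  rw [this]
  exact isOpen_iInter_of_finite fun i => isOpen_lt continuous_const (continuous_apply i)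

/-- Rademacher is available for the composite on `V`, so differentiability is assumed there and
carried back to `f` through the smooth local inverse `ψ` of the power map. -/
theorem mul_partialDeriv_comp_coordPow {n ℓ : ℕ} (hℓ : ℓ ≠ 0) {f : (Fin n → ℝ) → ℝ}
    {y : Fin n → ℝ} (hy : y ∈ posOrthant n)
    (hd : DifferentiableAt ℝ (fun y => f (coordPow ℓ y)) y) (i : Fin n) :
    y i * partialDeriv i (fun y => f (coordPow ℓ y)) y =
      ℓ * (coordPow ℓ y i * partialDeriv i f (coordPow ℓ y)) := by
  set ψ : (Fin n → ℝ) → (Fin n → ℝ) := fun x i => x i ^ ((ℓ : ℝ)⁻¹) with hψ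
  have hψφ : ψ (coordPow ℓ y) = y := funext fun i => Real.pow_rpow_inv_natCast (hy i).le hℓ
  have hφy := coordPow_mem_posOrthant ℓ hy
  have hψd : DifferentiableAt ℝ ψ (coordPow ℓ y) := by
    refine differentiableAt_pi.2 fun i => ?_
    exact DifferentiableAt.rpow_const (by fun_prop) (.inl (hφy i).ne')
  have hfd : DifferentiableAt ℝ f (coordPow ℓ y) := by
    have h1 : DifferentiableAt ℝ ((fun y => f (coordPow ℓ y)) ∘ ψ) (coordPow ℓ y) :=
      DifferentiableAt.comp _ (by rwa [hψφ]) hψd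
    refine h1.congr_of_eventuallyEq ?_
    filter_upwards [(isOpen_posOrthant n).mem_nhds hφy] with x hx
    simp only [Function.comp_apply]
    congr 1
    exact funext fun i => (Real.rpow_inv_natCast_pow (hx i).le hℓ).symm
  have hcomp : fderiv ℝ (fun y => f (coordPow ℓ y)) y =
      (fderiv ℝ f (coordPow ℓ y)).comp (coordPowDeriv ℓ y) :=
    (hfd.hasFDerivAt.comp y (hasFDerivAt_coordPow ℓ y)).fderiv
  have hsingle : coordPowDeriv ℓ y (Pi.single i 1) =
      ((ℓ : ℝ) * y i ^ (ℓ - 1)) • (Pi.single i 1 : Fin n → ℝ) := by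
    ext j
    rcases eq_or_ne j i with rfl | h
    · simp [coordPowDeriv]
    · simp [coordPowDeriv, h]
  rw [partialDeriv, partialDeriv, hd.lineDeriv_eq_fderiv, hfd.lineDeriv_eq_fderiv, hcomp,
    ContinuousLinearMap.comp_apply, hsingle, map_smul, smul_eq_mul, coordPow,
    ← mul_pow_sub_one hℓ]
  ring

/-- Take the interior of the convex set of `ℓ`-th roots: the frontier of a convex set is null, and
the differentiable power map sends null sets to null sets. -/
theorem IsPConvex.exists_isOpen_convex_image_ae_eq {n ℓ : ℕ} (hℓ : ℓ ≠ 0) {K : Set (Fin n → ℝ)}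
    (hK : IsPConvex (1 / (ℓ : ℝ)) K) : ∃ V : Set (Fin n → ℝ), IsOpen V ∧ Convex ℝ V ∧
      V ⊆ posOrthant n ∧ coordPow ℓ '' V ⊆ K ∧ (coordPow ℓ '' V : Set (Fin n → ℝ)) =ᵐ[volume] K := by
  obtain ⟨hpos, hconv⟩ := hK
  rw [one_div] at hconv
  set P := (fun (x : Fin n → ℝ) (i : Fin n) => x i ^ ((ℓ : ℝ)⁻¹)) '' K with hP
  have hPK : coordPow ℓ '' P = K := by
    rw [hP, Set.image_image]
    have : ∀ x ∈ K, coordPow ℓ (fun i => x i ^ ((ℓ : ℝ)⁻¹)) = x := fun x hx =>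
      funext fun i => Real.rpow_inv_natCast_pow (hpos hx i).le hℓ
    rw [Set.image_congr this, Set.image_id']
  have hPpos : P ⊆ posOrthant n := by
    rintro _ ⟨x, hx, rfl⟩ i
    exact Real.rpow_pos_of_pos (hpos hx i) _
  have hVK : coordPow ℓ '' interior P ⊆ K := by
    conv_rhs => rw [← hPK]
    exact Set.image_mono interior_subset
  refine ⟨interior P, isOpen_interior, hconv.interior, interior_subset.trans hPpos, hVK, ?_⟩
  refine Filter.EventuallyLE.antisymm (LE.le.eventuallyLE hVK) ?_
  rw [ae_le_set]
  have hnull : volume (P \ interior P) = 0 :=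
    measure_mono_null (Set.sdiff_subset_sdiff_left subset_closure) (hconv.addHaar_frontier volume)
  refine measure_mono_null ?_ (addHaar_image_eq_zero_of_differentiableOn_of_addHaar_eq_zero volume
    (f := coordPow ℓ) (fun y _ => (hasFDerivAt_coordPow ℓ y).differentiableAt.differentiableWithinAt)
    hnull)
  conv_lhs => rw [← hPK]
  rintro _ ⟨⟨y, hy, rfl⟩, hn⟩
  exact ⟨y, ⟨hy, fun h => hn ⟨y, h, rfl⟩⟩, rfl⟩

/-! ### The weighted Poincaré inequality -/

theorem corollary1p2 (n ℓ : ℕ) (hn : 1 ≤ n) (hℓ : 1 < ℓ)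
    (K : Set (Fin n → ℝ)) (hK : IsPConvex (1 / (ℓ : ℝ)) K) (hKint : (interior K).Nonempty)
    (f : (Fin n → ℝ) → ℝ) (hLip : LocallyLipschitzOn K f)
    (hint : IntegrableOn f K volume) (hzero : ∫ x in K, f x = 0) :
    ∫⁻ x in K, ENNReal.ofReal (f x ^ 2) ≤
      ENNReal.ofReal ((ℓ : ℝ) ^ 2 / ((ℓ : ℝ) - 1)) *
        ∑ i : Fin n, ∫⁻ x in K, ENNReal.ofReal (x i ^ 2 * |partialDeriv i f x| ^ 2) := by
  have hℓ0 : ℓ ≠ 0 := by omega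
  obtain ⟨V, hVo, hVc, hVpos, hVK, hae⟩ := hK.exists_isOpen_convex_image_ae_eq hℓ0
  have hres : volume.restrict K = volume.restrict (coordPow ℓ '' V) :=
    (Measure.restrict_congr_set hae).symm
  rw [IntegrableOn, hres] at hint
  rw [hres, integral_image_coordPow hℓ0 hVo.measurableSet hVpos] at hzero
  have hgi := integrableOn_image_coordPow hℓ0 hVo.measurableSet hVpos hint
  have hg : LocallyLipschitzOn V fun y => f (coordPow ℓ y) := by
    have hφ : LocallyLipschitz (coordPow ℓ : (Fin n → ℝ) → (Fin n → ℝ)) :=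
      ContDiff.locallyLipschitz (𝕂 := ℝ) (contDiff_pi.2 fun i => by unfold coordPow; fun_prop)
    intro y hy
    obtain ⟨A, s, hs, hfs⟩ := hLip (hVK (Set.mem_image_of_mem _ hy))
    obtain ⟨B, t, ht, hφt⟩ := hφ y
    refine ⟨A * B, t ∩ coordPow ℓ ⁻¹' s ∩ V, ?_, ?_⟩
    · refine Filter.inter_mem (Filter.inter_mem (mem_nhdsWithin_of_mem_nhds ht) ?_)
        self_mem_nhdsWithin
      exact (hφ.continuous.continuousWithinAt.tendsto_nhdsWithin
        fun z hz => hVK (Set.mem_image_of_mem _ hz)) hs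
    · exact hfs.comp (hφt.mono fun z hz => hz.1.1) fun z hz => hz.1.2
  have key := brascampLieb_monomialMeasure_sum (Nat.sub_pos_of_lt hℓ)
    (Nat.cast_pos.2 (Nat.pos_of_ne_zero hℓ0)) hVo hVc hVpos hg hgi hzero
  rw [hres]
  simp only [lintegral_image_coordPow hℓ0 hVo.measurableSet hVpos]
  refine key.trans (le_of_eq ?_)
  -- `1 / (ℓ - 1)` is the Brascamp–Lieb factor for exponent `m = ℓ - 1`; `ℓ ^ 2` comes from squaring
  -- the chain rule.
  have hsq : (ℓ : ℝ) ^ 2 / ((ℓ : ℝ) - 1) = 1 / ((ℓ - 1 : ℕ) : ℝ) * ℓ ^ 2 := by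
    rw [Nat.cast_sub hℓ.le]
    push_cast
    ring
  rw [hsq, ENNReal.ofReal_mul (by positivity), mul_assoc]
  congr 1
  rw [Finset.mul_sum]
  refine Finset.sum_congr rfl fun i _ => ?_
  rw [← lintegral_const_mul' _ _ ENNReal.ofReal_ne_top]
  refine lintegral_congr_ae (ae_monomialMeasure_of_ae hVo.measurableSet ?_)
  filter_upwards [hg.ae_differentiableAt_of_convex hVo hVc] with y hy hyV
  rw [mul_partialDeriv_comp_coordPow hℓ0 (hVpos hyV) (hy hyV), ← ENNReal.ofReal_mul (by positivity),
    sq_abs]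
  congr 1
  ring
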